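/- **Theorem.** Let $\ell_1,\ell_2>0$. On $\mathbb R^2\times T^2$ with coordinates $(x_1,x_2,\alpha_1,\alpha_2)$, where $T=\mathbb R/2\pi\mathbb Z$, let $\mathcal C$ be the whole space if $\ell_1\ne\ell_2$ and the open set $\{\alpha_1\neq\alpha_2\}$ if $\ell_1=\ell_2$. Let $\mathcal D$ be the rank two distribution on $\mathcal C$ given by $$\sin\alpha_i\,dx_1-\cos\alpha_i\,dx_2+\ell_i\,d\alpha_i=0,\qquad i=1,2,$$ which is spanned by $$v_1=\partial_{x_1}-\frac{\sin\alpha_1}{\ell_1}\partial_{\alpha_1}-\frac{\sin\alpha_2}{\ell_2}\partial_{\alpha_2},\qquad v_2=\partial_{x_2}+\frac{\cos\alpha_1}{\ell_1}\partial_{\alpha_1}+\frac{\cos\alpha_2}{\ell_2}\partial_{\alpha_2}.$$ A horizontal path is an absolutely continuous curve $\gamma:[a,b]\to\mathcal C$, $a<b$, with square integrable velocity tangent to $\mathcal D$ almost everywhere. The horizontal paths on $[a,b]$ with a given initial point are parametrized by $u\in L^2([a,b],\mathbb R^2)$ through $\dot\gamma=u_1v_1(\gamma)+u_2v_2(\gamma)$.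 A horizontal path is a *singular (abnormal) curve* if it is a critical point of the endpoint map $u\mapsto\gamma(b)$ on the space of horizontal paths with the same initial point, that is, if the differential of this map is not surjective. Then the singular curves in $\mathcal C$ are, up to parametrization, the integral curves of the vector field $$\xi=\left(\frac{\sin\alpha_1}{\ell_1}-\frac{\sin\alpha_2}{\ell_2}\right)v_1-\left(\frac{\cos\alpha_1}{\ell_1}-\frac{\cos\alpha_2}{\ell_2}\right)v_2 .$$ Precisely: 1. every integral curve $[a,b]\to\mathcal C$ of $\xi$ is a singular curve; 2. a $C^1$ curve $\gamma:[a,b]\to\mathcal C$ with nowhere vanishing velocity is singular if and only if $\gamma=c\circ\varphi$ for an integral curve $c:\mathbb R\to\mathcal C$ of $\xi$ and a $C^1$ function $\varphi:[a,b]\to\mathbb R$ with nowhere vanishing derivative; 3. an arbitrary curve $\gamma:[a,b]\to\mathcal C$ is singular if and only if $\gamma=c\circ\varphi$ for an integral curve $c:\mathbb R\to\mathcal C$ of $\xi$ and an absolutely continuous function $\varphi:[a,b]\to\mathbb R$ with square integrable derivative. -/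

import Mathlib

open MeasureTheory Filter Topology Set

noncomputable section

namespace TwoLinkage

/-- The space `ℝ² × T²` of positions `(x₁, x₂, α₁, α₂)` of the linkage. -/
abbrev Pos : Type := ℝ × ℝ × Real.Angle × Real.Angle

/-- Tangent vectors of `ℝ² × T²`, in the global frame `∂x₁, ∂x₂, ∂α₁, ∂α₂`. -/
abbrev Vec : Type := ℝ × ℝ × ℝ × ℝ

/-- The universal covering homomorphism `ℝ⁴ → ℝ² × T²`. -/
def cover (w : Vec) : Pos := (w.1, w.2.1, (w.2.2.1 : Real.Angle), (w.2.2.2 : Real.Angle))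

/-- The reduced configuration space: if `ℓ₁ = ℓ₂`, then `α₁ ≠ α₂`. -/
def configSpace (ℓ₁ ℓ₂ : ℝ) : Set Pos := {q | ℓ₁ = ℓ₂ → q.2.2.1 ≠ q.2.2.2}

/-- The Pfaffian form `sin α₁ dx₁ - cos α₁ dx₂ + ℓ₁ dα₁` (no slip at `m₁`). -/
def form₁ (ℓ₁ : ℝ) (q : Pos) : Vec →ₗ[ℝ] ℝ where
  toFun w := q.2.2.1.sin * w.1 - q.2.2.1.cos * w.2.1 + ℓ₁ * w.2.2.1
  map_add' w w' := by simp only [Prod.fst_add, Prod.snd_add]; ring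
  map_smul' r w := by simp only [Prod.smul_fst, Prod.smul_snd, smul_eq_mul, RingHom.id_apply]; ring

/-- The Pfaffian form `sin α₂ dx₁ - cos α₂ dx₂ + ℓ₂ dα₂` (no slip at `m₂`). -/
def form₂ (ℓ₂ : ℝ) (q : Pos) : Vec →ₗ[ℝ] ℝ where
  toFun w := q.2.2.2.sin * w.1 - q.2.2.2.cos * w.2.1 + ℓ₂ * w.2.2.2
  map_add' w w' := by simp only [Prod.fst_add, Prod.snd_add]; ring
  map_smul' r w := by simp only [Prod.smul_fst, Prod.smul_snd, smul_eq_mul, RingHom.id_apply]; ring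

/-- The distribution `𝓓` of the no-slip constraints. -/
def distribution (ℓ₁ ℓ₂ : ℝ) (q : Pos) : Submodule ℝ Vec :=
  LinearMap.ker (form₁ ℓ₁ q) ⊓ LinearMap.ker (form₂ ℓ₂ q)

/-- The horizontal field `v₁ = ∂x₁ - (sin α₁ / ℓ₁) ∂α₁ - (sin α₂ / ℓ₂) ∂α₂`. -/
def v₁ (ℓ₁ ℓ₂ : ℝ) (q : Pos) : Vec := (1, 0, -(q.2.2.1.sin / ℓ₁), -(q.2.2.2.sin / ℓ₂))

/-- The horizontal field `v₂ = ∂x₂ + (cos α₁ / ℓ₁) ∂α₁ + (cos α₂ / ℓ₂) ∂α₂`. -/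
def v₂ (ℓ₁ ℓ₂ : ℝ) (q : Pos) : Vec := (0, 1, q.2.2.1.cos / ℓ₁, q.2.2.2.cos / ℓ₂)

/-- `v₁, v₂` is a global frame of `𝓓`. -/
theorem mem_distribution_iff {ℓ₁ ℓ₂ : ℝ} (h₁ : 0 < ℓ₁) (h₂ : 0 < ℓ₂) (q : Pos) (w : Vec) :
    w ∈ distribution ℓ₁ ℓ₂ q ↔ w = w.1 • v₁ ℓ₁ ℓ₂ q + w.2.1 • v₂ ℓ₁ ℓ₂ q := by
  obtain ⟨a, b, c, d⟩ := w
  simp only [distribution, form₁, form₂, v₁, v₂, Submodule.mem_inf, LinearMap.mem_ker,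
    LinearMap.coe_mk, AddHom.coe_mk, Prod.smul_mk, Prod.mk_add_mk, Prod.mk.injEq, smul_eq_mul]
  field_simp
  constructor
  · rintro ⟨h, h'⟩
    refine ⟨by ring, by ring, by linarith, by linarith⟩
  · rintro ⟨-, -, h, h'⟩
    exact ⟨by linarith, by linarith⟩

/-- The vector field `ξ`. -/
def ξ (ℓ₁ ℓ₂ : ℝ) (q : Pos) : Vec :=
  (q.2.2.1.sin / ℓ₁ - q.2.2.2.sin / ℓ₂) • v₁ ℓ₁ ℓ₂ q
    - (q.2.2.1.cos / ℓ₁ - q.2.2.2.cos / ℓ₂) • v₂ ℓ₁ ℓ₂ q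

/-- `L` is the differential at `x` of the map `f` into `ℝ² × T²`, in the global frame of the
target: near `x`, `f` is `f x` plus the projection of a map `δ` into `ℝ⁴` with `δ x = 0` whose
Fréchet derivative at `x` is `L`. -/
def HasDifferentialAt {F : Type*} [NormedAddCommGroup F] [NormedSpace ℝ F]
    (f : F → Pos) (L : F →L[ℝ] Vec) (x : F) : Prop :=
  ∃ δ : F → Vec, δ x = 0 ∧ HasFDerivAt δ L x ∧ ∀ᶠ y in 𝓝 x, f y = f x + cover (δ y)

/-- The curve `γ` has velocity `w` at time `t`. -/
def HasVelocityAt (γ : ℝ → Pos) (w : Vec) (t : ℝ) : Prop :=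
  HasDifferentialAt γ (ContinuousLinearMap.toSpanSingleton ℝ w) t

/-- `γ` is absolutely continuous on `[a, b]` with square integrable velocity `w`. -/
def HasL2Velocity (a b : ℝ) (γ : ℝ → Pos) (w : ℝ → Vec) : Prop :=
  MemLp w 2 (volume.restrict (Icc a b)) ∧
    ∀ t ∈ Icc a b, γ t = γ a + cover (∫ s in a..t, w s)

/-- `γ` is a horizontal path on `[a, b]`: absolutely continuous, with square integrable velocity
that is tangent to `𝓓` almost everywhere. -/
def IsHorizontal (ℓ₁ ℓ₂ a b : ℝ) (γ : ℝ → Pos) : Prop :=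
  ∃ w : ℝ → Vec, HasL2Velocity a b γ w ∧
    ∀ᵐ s ∂(volume.restrict (Icc a b)), w s ∈ distribution ℓ₁ ℓ₂ (γ s)

/-- The Hilbert space `L²([a, b], ℝ²)`. In the global frame `v₁, v₂` of `𝓓` it parametrizes the
space of horizontal paths on `[a, b]` with a given initial point. -/
abbrev Control (a b : ℝ) : Type := Lp (EuclideanSpace ℝ (Fin 2)) 2 (volume.restrict (Icc a b))

/-- `γ` is a horizontal path on `[a, b]` with velocity `u₁ v₁ + u₂ v₂`. -/
def IsControlledBy (ℓ₁ ℓ₂ a b : ℝ) (γ : ℝ → Pos) (u : Control a b) : Prop :=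
  HasL2Velocity a b γ fun s => u s 0 • v₁ ℓ₁ ℓ₂ (γ s) + u s 1 • v₂ ℓ₁ ℓ₂ (γ s)

/-- `E` is the endpoint map of the space of horizontal paths on `[a, b]` that start at `q`. -/
def IsEndpointMap (ℓ₁ ℓ₂ a b : ℝ) (q : Pos) (E : Control a b → Pos) : Prop :=
  ∀ u : Control a b, ∃ η : ℝ → Pos, IsControlledBy ℓ₁ ℓ₂ a b η u ∧ η a = q ∧ η b = E u

/-- `γ` is a singular (abnormal) curve on `[a, b]`: a horizontal path that is a critical point of
the endpoint map on the space of horizontal paths with the same initial point. -/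
def IsSingular (ℓ₁ ℓ₂ a b : ℝ) (γ : ℝ → Pos) : Prop :=
  IsHorizontal ℓ₁ ℓ₂ a b γ ∧
    ∃ u : Control a b, IsControlledBy ℓ₁ ℓ₂ a b γ u ∧
      ∃ E : Control a b → Pos, IsEndpointMap ℓ₁ ℓ₂ a b (γ a) E ∧
        ∃ L : Control a b →L[ℝ] Vec, HasDifferentialAt E L u ∧ ¬ Function.Surjective L

/-- `c` is an integral curve of `ξ` on `s` that lies in the configuration space. -/
def IsIntegralCurve (ℓ₁ ℓ₂ : ℝ) (c : ℝ → Pos) (s : Set ℝ) : Prop :=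
  ∀ t ∈ s, c t ∈ configSpace ℓ₁ ℓ₂ ∧ HasVelocityAt c (ξ ℓ₁ ℓ₂ (c t)) t

/-- `γ` is a regular `C¹` curve on `[a, b]`: its velocity is continuous and vanishes nowhere. -/
def IsRegularCurve (a b : ℝ) (γ : ℝ → Pos) : Prop :=
  ∃ w : ℝ → Vec, ContinuousOn w (Icc a b) ∧ (∀ t ∈ Icc a b, w t ≠ 0) ∧
    ∀ t ∈ Icc a b, γ t = γ a + cover (∫ s in a..t, w s)

/-- `φ` is absolutely continuous on `[a, b]` with square integrable derivative. -/
def IsH1 (a b : ℝ) (φ : ℝ → ℝ) : Prop :=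
  ∃ f : ℝ → ℝ, MemLp f 2 (volume.restrict (Icc a b)) ∧
    ∀ t ∈ Icc a b, φ t = φ a + ∫ s in a..t, f s

/-- `φ` is a regular `C¹` change of parameter on `[a, b]`. -/
def IsRegularReparam (a b : ℝ) (φ : ℝ → ℝ) : Prop :=
  ∃ f : ℝ → ℝ, ContinuousOn f (Icc a b) ∧ (∀ t ∈ Icc a b, f t ≠ 0) ∧
    ∀ t ∈ Icc a b, HasDerivWithinAt φ (f t) (Icc a b) t

end TwoLinkage

end

open MeasureTheory Filter Topology Set

noncomputable section

namespace TwoLinkage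

/-! In the universal cover a control `u` moves the base point by `x' = u`, and each angle obeys its
own steering equation `ℓᵢ θᵢ' = u₂ cos θᵢ - u₁ sin θᵢ`. Up to a translation and the covering
projection, the endpoint map is therefore `(∫ u₁, ∫ u₂, θ₁(b), θ₂(b))`. Linearizing the steering
equation shows that `θᵢ(b)` has gradient `Qᵢ (-sin θᵢ, cos θᵢ) / ℓᵢ` in `L²`, where `Qᵢ = exp (Aᵢ -
Aᵢ(b))` and `ℓᵢ Aᵢ' = u₁ cos θᵢ + u₂ sin θᵢ` (`hasFDerivAt_liftAngle`). So `u` is critical exactly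
when a nonzero covector `p` makes a combination of continuous gradients vanish on all of `[a, b]`
(`not_surjective_iff`).

The key identities are `(Qᵢ sin θᵢ)' = Qᵢ u₂ / ℓᵢ` and `(Qᵢ cos θᵢ)' = Qᵢ u₁ / ℓᵢ`. Differentiating
the covector relations gives `h u = 0` with `h = p₃ Q₁ / ℓ₁² + p₄ Q₂ / ℓ₂²`. Since `h'` is linear in
`u`, `h h' = 0` and `h²` is constant. Either `h` never vanishes and `u = 0`, or `h` is identically
zero, `Q₁ / Q₂` is constant and `A₁' = A₂'`. The last equation says that `u` is orthogonal to the
rotated coefficients of `ξ` (`orthogonal_of_not_surjective`). Conversely `A₁' = A₂'` gives `Q₁ =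
Q₂`, and then `ℓ₁ Q₁ sin θ₁ - ℓ₂ Q₂ sin θ₂` and its cosine analogue are constants that provide the
covector (`not_surjective_of_orthogonal`).

It remains to pass from velocity `f ξ` to a reparametrization. Along `ξ` the difference of the
angles solves an autonomous scalar equation with bounded Lipschitz right-hand side, and the other
coordinates follow from it by integration; hence integral curves are global, and `γ = c ∘ ∫ f` by a
Grönwall argument (`exists_integralCurve_eq`). On the configuration space `ξ` has no zero, so `f`
inherits square integrability or continuity from the velocity. -/

/-! ### Calculus of absolutely continuous functions on an interval -/

/-- `F` is a primitive of the integrable function `f` on `[a, b]`. -/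
def IsPrimitiveOn (a b : ℝ) (F f : ℝ → ℝ) : Prop :=
  IntegrableOn f (Icc a b) ∧ ∀ t ∈ Icc a b, F t = F a + ∫ s in a..t, f s

/-- A Lipschitz function of an absolutely continuous function is absolutely continuous. -/
theorem absolutelyContinuousOnInterval_comp {G F : ℝ → ℝ} {a b : ℝ} {K : NNReal} {S : Set ℝ}
    (hG : LipschitzOnWith K G S) (hF : AbsolutelyContinuousOnInterval F a b)
    (hS : MapsTo F (uIcc a b) S) : AbsolutelyContinuousOnInterval (G ∘ F) a b := by
  rw [absolutelyContinuousOnInterval_iff] at hF ⊢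
  intro ε hε
  -- `K + 1` instead of `K`, since `K` may be zero.
  obtain ⟨δ, hδ, h⟩ := hF (ε / (K + 1)) (by positivity)
  refine ⟨δ, hδ, fun E hE hlt => ?_⟩
  calc
    _ ≤ ∑ i ∈ Finset.range E.1, K * dist (F (E.2 i).1) (F (E.2 i).2) :=
      Finset.sum_le_sum fun i hi => hG.dist_le_mul _ (hS (hE.1 i hi).1) _ (hS (hE.1 i hi).2)
    _ = K * ∑ i ∈ Finset.range E.1, dist (F (E.2 i).1) (F (E.2 i).2) := by rw [Finset.mul_sum]
    _ ≤ K * (ε / (K + 1)) := by gcongr; exact (h E hE hlt).le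
    _ < (K + 1) * (ε / (K + 1)) := by gcongr; linarith
    _ = ε := by field

variable {a b : ℝ}

section Primitive

variable {F G f g : ℝ → ℝ}

theorem ae_restrict_Icc_iff {p : ℝ → Prop} (hab : a ≤ b) :
    (∀ᵐ x ∂(volume.restrict (Icc a b)), p x) ↔ ∀ᵐ x, x ∈ uIcc a b → p x := by
  rw [ae_restrict_iff' measurableSet_Icc, uIcc_of_le hab]

theorem isPrimitiveOn_of_absolutelyContinuous (hab : a ≤ b)
    (hF : AbsolutelyContinuousOnInterval F a b)
    (h : ∀ᵐ x, x ∈ uIcc a b → HasDerivAt F (f x) x) : IsPrimitiveOn a b F f := by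
  have hd : ∀ᵐ x ∂(volume.restrict (Icc a b)), deriv F x = f x := by
    rw [ae_restrict_Icc_iff hab]
    filter_upwards [h] with x hx hm using (hx hm).deriv
  refine ⟨?_, fun t ht => ?_⟩
  · have := hF.intervalIntegrable_deriv
    rw [intervalIntegrable_iff_integrableOn_Icc_of_le hab] at this
    exact this.congr_fun_ae hd
  · have hsub : uIcc a t ⊆ uIcc a b := by
      rw [uIcc_of_le hab, uIcc_of_le ht.1]; exact Icc_subset_Icc_right ht.2
    have := (hF.mono hsub).integral_deriv_eq_sub
    rw [intervalIntegral.integral_congr_ae (g := f)] at this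
    · linarith
    · rw [ae_restrict_Icc_iff hab] at hd
      filter_upwards [hd] with x hx hm using hx (hsub (uIoc_subset_uIcc hm))

theorem IsPrimitiveOn.intervalIntegrable (hF : IsPrimitiveOn a b F f) (hab : a ≤ b) :
    IntervalIntegrable f volume a b := by
  rw [intervalIntegrable_iff_integrableOn_Icc_of_le hab]; exact hF.1

theorem IsPrimitiveOn.congr_left (hF : IsPrimitiveOn a b F f) (hab : a ≤ b)
    (h : EqOn F G (Icc a b)) : IsPrimitiveOn a b G f :=
  ⟨hF.1, fun t ht => by rw [← h ht, ← h (left_mem_Icc.2 hab), hF.2 t ht]⟩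

theorem IsPrimitiveOn.congr_right (hF : IsPrimitiveOn a b F f) (hab : a ≤ b)
    (h : ∀ᵐ x ∂(volume.restrict (Icc a b)), f x = g x) : IsPrimitiveOn a b F g := by
  refine ⟨hF.1.congr_fun_ae h, fun t ht => ?_⟩
  rw [hF.2 t ht, intervalIntegral.integral_congr_ae (g := g)]
  rw [ae_restrict_Icc_iff hab] at h
  filter_upwards [h] with x hx hm
  refine hx ?_
  rw [uIcc_of_le hab]
  rw [uIoc_of_le ht.1] at hm
  exact ⟨hm.1.le, hm.2.trans ht.2⟩

theorem IsPrimitiveOn.congr_right' (hF : IsPrimitiveOn a b F f) (hab : a ≤ b)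
    (h : EqOn f g (Icc a b)) : IsPrimitiveOn a b F g :=
  hF.congr_right hab ((ae_restrict_iff' measurableSet_Icc).2 (Eventually.of_forall h))

/-- A primitive agrees on `[a, b]` with an absolutely continuous function that is differentiable
almost everywhere. -/
theorem IsPrimitiveOn.exists_absolutelyContinuous (hF : IsPrimitiveOn a b F f) (hab : a ≤ b) :
    ∃ F' : ℝ → ℝ, EqOn F' F (Icc a b) ∧ AbsolutelyContinuousOnInterval F' a b ∧
      ∀ᵐ x, x ∈ uIcc a b → HasDerivAt F' (f x) x := by
  have hi := hF.intervalIntegrable hab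
  -- `F` is unconstrained outside `[a, b]`, so two-sided derivatives are taken of the integral
  -- formula instead.
  refine ⟨fun t => F a + ∫ s in a..t, f s, fun t ht => (hF.2 t ht).symm, ?_, ?_⟩
  · have h0 : AbsolutelyContinuousOnInterval (fun _ : ℝ => F a) a b :=
      (LipschitzWith.const (F a)).lipschitzOnWith.absolutelyContinuousOnInterval
    exact h0.add (hi.absolutelyContinuousOnInterval_intervalIntegral left_mem_uIcc)
  · filter_upwards [hi.ae_hasDerivAt_integral] with x hx hm
    exact (hx hm a left_mem_uIcc).const_add _

theorem IsPrimitiveOn.continuousOn (hF : IsPrimitiveOn a b F f) (hab : a ≤ b) :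
    ContinuousOn F (Icc a b) := by
  obtain ⟨F', he, hac, -⟩ := hF.exists_absolutelyContinuous hab
  have := hac.continuousOn
  rw [uIcc_of_le hab] at this
  exact this.congr he.symm

/-- The chain rule for a `C¹` function of a primitive. -/
theorem IsPrimitiveOn.comp {H H' : ℝ → ℝ} (hF : IsPrimitiveOn a b F f) (hab : a ≤ b)
    (hH : ∀ x, HasDerivAt H (H' x) x) (hc : Continuous H') :
    IsPrimitiveOn a b (fun t => H (F t)) (fun t => H' (F t) * f t) := by
  obtain ⟨F', he, hac, hd⟩ := hF.exists_absolutelyContinuous hab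
  obtain ⟨C, hC⟩ := hac.exists_bound
  -- `H` is Lipschitz only on compact sets, so the range is first confined to `[-C, C]`.
  have hS : MapsTo F' (uIcc a b) (Icc (-C) C) := fun x hx => abs_le.1 (hC x hx)
  obtain ⟨K, hK⟩ := (isCompact_Icc (a := -C) (b := C)).exists_bound_of_continuousOn hc.continuousOn
  have hlip : LipschitzOnWith K.toNNReal H (Icc (-C) C) := by
    refine (convex_Icc _ _).lipschitzOnWith_of_nnnorm_hasDerivWithin_le
      (fun x _ => (hH x).hasDerivWithinAt) fun x hx => ?_
    rw [← NNReal.coe_le_coe, coe_nnnorm]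
    exact (hK x hx).trans (Real.le_coe_toNNReal K)
  have h1 : IsPrimitiveOn a b (H ∘ F') (fun t => H' (F' t) * f t) := by
    refine isPrimitiveOn_of_absolutelyContinuous hab
      (absolutelyContinuousOnInterval_comp hlip hac hS) ?_
    filter_upwards [hd] with x hx hm using (hH _).comp x (hx hm)
  refine (h1.congr_left hab (G := fun t => H (F t)) fun t ht => ?_).congr_right' hab fun t ht => ?_
  · simp [he ht]
  · simp [he ht]

theorem IsPrimitiveOn.mul (hF : IsPrimitiveOn a b F f) (hG : IsPrimitiveOn a b G g)
    (hab : a ≤ b) :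
    IsPrimitiveOn a b (fun t => F t * G t) (fun t => f t * G t + F t * g t) := by
  obtain ⟨F', he, hac, hd⟩ := hF.exists_absolutelyContinuous hab
  obtain ⟨G', he', hac', hd'⟩ := hG.exists_absolutelyContinuous hab
  have h1 : IsPrimitiveOn a b (F' * G') (fun t => f t * G' t + F' t * g t) := by
    refine isPrimitiveOn_of_absolutelyContinuous hab (hac.mul hac') ?_
    filter_upwards [hd, hd'] with x hx hx' hm using (hx hm).mul (hx' hm)
  refine (h1.congr_left hab (G := fun t => F t * G t) fun t ht => ?_).congr_right' hab
    fun t ht => ?_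
  · simp [he ht, he' ht]
  · simp [he ht, he' ht]

theorem isPrimitiveOn_const (c : ℝ) : IsPrimitiveOn a b (fun _ => c) (fun _ => 0) :=
  ⟨integrableOn_zero, fun t _ => by simp⟩

theorem IsPrimitiveOn.const_mul (hF : IsPrimitiveOn a b F f) (c : ℝ) :
    IsPrimitiveOn a b (fun t => c * F t) (fun t => c * f t) :=
  ⟨hF.1.const_mul c, fun t ht => by
    beta_reduce
    rw [hF.2 t ht, intervalIntegral.integral_const_mul]; ring⟩

theorem IsPrimitiveOn.mono_integrable (hF : IsPrimitiveOn a b F f) {t : ℝ} (ht : t ∈ Icc a b) :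
    IntervalIntegrable f volume a t := by
  rw [intervalIntegrable_iff_integrableOn_Icc_of_le ht.1]
  exact hF.1.mono_set (Icc_subset_Icc_right ht.2)

theorem IsPrimitiveOn.add (hF : IsPrimitiveOn a b F f) (hG : IsPrimitiveOn a b G g) :
    IsPrimitiveOn a b (fun t => F t + G t) (fun t => f t + g t) :=
  ⟨hF.1.add hG.1, fun t ht => by
    beta_reduce
    rw [hF.2 t ht, hG.2 t ht, intervalIntegral.integral_add (hF.mono_integrable ht)
      (hG.mono_integrable ht)]; ring⟩

theorem IsPrimitiveOn.sub (hF : IsPrimitiveOn a b F f) (hG : IsPrimitiveOn a b G g) :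
    IsPrimitiveOn a b (fun t => F t - G t) (fun t => f t - g t) :=
  ⟨hF.1.sub hG.1, fun t ht => by
    beta_reduce
    rw [hF.2 t ht, hG.2 t ht, intervalIntegral.integral_sub (hF.mono_integrable ht)
      (hG.mono_integrable ht)]; ring⟩

theorem isPrimitiveOn_integral (hf : IntegrableOn f (Icc a b)) (c : ℝ) :
    IsPrimitiveOn a b (fun t => c + ∫ s in a..t, f s) f :=
  ⟨hf, fun t _ => by simp⟩

/-- The derivative of a primitive is determined almost everywhere. -/
theorem IsPrimitiveOn.ae_eq (hF : IsPrimitiveOn a b F f) (hG : IsPrimitiveOn a b F g)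
    (hab : a ≤ b) : ∀ᵐ x ∂(volume.restrict (Icc a b)), f x = g x := by
  have h0 := hF.sub hG
  simp only [sub_self] at h0
  obtain ⟨F', he, hac, hd⟩ := h0.exists_absolutelyContinuous hab
  have hIoo : ∀ᵐ x ∂(volume.restrict (Icc a b)), x ∈ Ioo a b := by
    rw [← restrict_Ioo_eq_restrict_Icc]
    exact ae_restrict_mem measurableSet_Ioo
  filter_upwards [(ae_restrict_Icc_iff hab).2 hd, hIoo] with x hx hm
  have h1 : F' =ᶠ[𝓝 x] fun _ => 0 :=
    eventually_of_mem (Icc_mem_nhds hm.1 hm.2) fun y hy => he hy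
  have := (hx.congr_of_eventuallyEq h1.symm).unique (hasDerivAt_const x (0 : ℝ))
  linarith

theorem IsPrimitiveOn.eq_of_ae_zero (hF : IsPrimitiveOn a b F f) (hab : a ≤ b)
    (h : ∀ᵐ x ∂(volume.restrict (Icc a b)), f x = 0) {t : ℝ} (ht : t ∈ Icc a b) : F t = F a := by
  have := (hF.congr_right hab (g := fun _ => 0) h).2 t ht
  simpa using this

theorem IsPrimitiveOn.eq_of_ae_eq (hF : IsPrimitiveOn a b F f) (hG : IsPrimitiveOn a b G g)
    (hab : a ≤ b) (h : ∀ᵐ x ∂(volume.restrict (Icc a b)), f x = g x) (h0 : F a = G a) {t : ℝ}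
    (ht : t ∈ Icc a b) : F t = G t := by
  rw [(hF.congr_right hab h).2 t ht, hG.2 t ht, h0]

theorem isPrimitiveOn_of_hasDerivWithinAt {H H' : ℝ → ℝ}
    (hH : ∀ x ∈ Icc a b, HasDerivWithinAt H (H' x) (Icc a b) x) (hc : ContinuousOn H' (Icc a b)) :
    IsPrimitiveOn a b H H' := by
  refine ⟨hc.integrableOn_Icc, fun t ht => ?_⟩
  have hs : Icc a t ⊆ Icc a b := Icc_subset_Icc_right ht.2
  have := intervalIntegral.integral_eq_sub_of_hasDerivAt_of_le ht.1
    (fun x hx => (hH x (hs hx)).continuousWithinAt.mono hs)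
    (fun x hx => (hH x ⟨hx.1.le, hx.2.le.trans ht.2⟩).hasDerivAt
      (Icc_mem_nhds hx.1 (hx.2.trans_le ht.2)))
    (hc.mono (by rw [uIcc_of_le ht.1]; exact hs)).intervalIntegrable
  linarith

end Primitive

/-! ### The steering equation: pointwise estimates -/

/-- The right-hand side of the steering equation `θ' = q cos θ - p sin θ`. -/
def steer (p q x : ℝ) : ℝ := q * Real.cos x - p * Real.sin x

theorem abs_mul_add_mul_le {c d p q x y r : ℝ} (hx : |x| ≤ r) (hy : |y| ≤ r)
    (hp : |p| = c) (hq : |q| = d) : |q * x - p * y| ≤ (c + d) * r := by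
  subst hp hq
  calc |q * x - p * y| ≤ |q * x| + |p * y| := abs_sub _ _
    _ = |q| * |x| + |p| * |y| := by rw [abs_mul, abs_mul]
    _ ≤ |q| * r + |p| * r := by gcongr
    _ = _ := by ring

theorem abs_steer_le (p q x : ℝ) : |steer p q x| ≤ |p| + |q| := by
  have := abs_mul_add_mul_le (Real.abs_cos_le_one x) (Real.abs_sin_le_one x) (rfl : |p| = _)
    (rfl : |q| = _)
  rwa [mul_one] at this

theorem abs_steer_sub_steer_le (p q x y : ℝ) :
    |steer p q x - steer p q y| ≤ (|p| + |q|) * |x - y| := by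
  have := abs_mul_add_mul_le (Real.abs_cos_sub_cos_le x y) (Real.abs_sin_sub_sin_le x y)
    (rfl : |p| = _) (rfl : |q| = _)
  convert this using 2
  simp only [steer]; ring

theorem abs_sin_sub_self_le (x : ℝ) : |Real.sin x - x| ≤ x ^ 2 := by
  wlog hx : 0 ≤ x generalizing x
  · have := this (-x) (by linarith)
    rw [Real.sin_neg, neg_sq, ← abs_neg] at this
    convert this using 2; ring
  rcases hx.eq_or_lt with rfl | hx
  · simp
  rw [abs_sub_comm, abs_of_nonneg (by linarith [Real.sin_le hx.le])]
  -- Up to `6` the cubic lower bound suffices, because `x ^ 3 / 6 ≤ x ^ 2`; beyond it `x - sin x ≤ x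
  -- + 1 ≤ x ^ 2`.
  rcases le_or_gt x 6 with h | h
  · nlinarith [Real.sin_gt_sub_cube hx, mul_nonneg (sq_nonneg x) (sub_nonneg.2 h)]
  · nlinarith [Real.neg_one_le_sin x]

theorem abs_cos_sub_one_le (x : ℝ) : |Real.cos x - 1| ≤ x ^ 2 := by
  rw [abs_sub_comm, abs_of_nonneg (by linarith [Real.cos_le_one x])]
  nlinarith [Real.one_sub_sq_div_two_le_cos (x := x)]

theorem abs_sin_taylor_le (x y : ℝ) :
    |Real.sin y - Real.sin x - Real.cos x * (y - x)| ≤ 2 * (y - x) ^ 2 := by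
  have h : Real.sin y - Real.sin x - Real.cos x * (y - x)
      = Real.cos x * (Real.sin (y - x) - (y - x)) - -Real.sin x * (Real.cos (y - x) - 1) := by
    conv_lhs => rw [show y = x + (y - x) by ring, Real.sin_add]
    ring_nf
  rw [h]
  refine (abs_mul_add_mul_le (abs_sin_sub_self_le _) (abs_cos_sub_one_le _) rfl rfl).trans ?_
  rw [abs_neg]
  gcongr
  linarith [Real.abs_sin_le_one x, Real.abs_cos_le_one x]

theorem abs_cos_taylor_le (x y : ℝ) :
    |Real.cos y - Real.cos x + Real.sin x * (y - x)| ≤ 2 * (y - x) ^ 2 := by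
  have h : Real.cos y - Real.cos x + Real.sin x * (y - x)
      = Real.cos x * (Real.cos (y - x) - 1) - Real.sin x * (Real.sin (y - x) - (y - x)) := by
    conv_lhs => rw [show y = x + (y - x) by ring, Real.cos_add]
    ring_nf
  rw [h]
  refine (abs_mul_add_mul_le (abs_cos_sub_one_le _) (abs_sin_sub_self_le _) rfl rfl).trans ?_
  gcongr
  linarith [Real.abs_sin_le_one x, Real.abs_cos_le_one x]

theorem abs_steer_taylor_le (p q x y : ℝ) :
    |steer p q y - steer p q x + (p * Real.cos x + q * Real.sin x) * (y - x)|
      ≤ (|p| + |q|) * (2 * (y - x) ^ 2) := by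
  have := abs_mul_add_mul_le (abs_cos_taylor_le x y) (abs_sin_taylor_le x y)
    (rfl : |p| = _) (rfl : |q| = _)
  convert this using 2
  simp only [steer]; ring

theorem integrableOn_steer {p q θ : ℝ → ℝ} (hp : IntegrableOn p (Icc a b))
    (hq : IntegrableOn q (Icc a b)) (hθ : ContinuousOn θ (Icc a b)) :
    IntegrableOn (fun s => steer (p s) (q s) (θ s)) (Icc a b) :=
  (hq.mul_continuousOn (Real.continuous_cos.comp_continuousOn hθ) isCompact_Icc).sub
    (hp.mul_continuousOn (Real.continuous_sin.comp_continuousOn hθ) isCompact_Icc)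

theorem intervalIntegrable_of_integrableOn_Icc {f : ℝ → ℝ} (hf : IntegrableOn f (Icc a b)) {t : ℝ}
    (ht : t ∈ Icc a b) : IntervalIntegrable f volume a t := by
  rw [intervalIntegrable_iff_integrableOn_Icc_of_le ht.1]
  exact hf.mono_set (Icc_subset_Icc_right ht.2)

theorem abs_integral_le_of_abs_le {f g : ℝ → ℝ} {t : ℝ} (ht : t ∈ Icc a b)
    (hg : IntegrableOn g (Icc a b)) (h : ∀ s ∈ Icc a b, |f s| ≤ g s) :
    |∫ s in a..t, f s| ≤ ∫ s in a..t, g s := by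
  rw [← Real.norm_eq_abs]
  exact intervalIntegral.norm_integral_le_of_norm_le ht.1
    (Eventually.of_forall fun s hs => h s ⟨hs.1.le, hs.2.trans ht.2⟩)
    (intervalIntegrable_of_integrableOn_Icc hg ht)

theorem integral_mono_of_le {f g : ℝ → ℝ} {t : ℝ} (ht : t ∈ Icc a b)
    (hf : IntegrableOn f (Icc a b)) (hg : IntegrableOn g (Icc a b))
    (h : ∀ s ∈ Icc a b, f s ≤ g s) : ∫ s in a..t, f s ≤ ∫ s in a..t, g s :=
  intervalIntegral.integral_mono_on ht.1 (intervalIntegrable_of_integrableOn_Icc hf ht)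
    (intervalIntegrable_of_integrableOn_Icc hg ht) fun s hs => h s ⟨hs.1, hs.2.trans ht.2⟩

theorem integral_mono_right {f : ℝ → ℝ} {t : ℝ} (ht : t ∈ Icc a b)
    (hf : IntegrableOn f (Icc a b)) (h : ∀ s, 0 ≤ f s) : ∫ s in a..t, f s ≤ ∫ s in a..b, f s :=
  intervalIntegral.integral_mono_interval le_rfl ht.1 ht.2 (Eventually.of_forall h)
    (intervalIntegrable_of_integrableOn_Icc hf ⟨ht.1.trans ht.2, le_rfl⟩)

/-! ### Grönwall's inequality and existence of solutions -/

section Kernel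

variable {k : ℝ → ℝ}

/-- With the weight `exp (2 K)`, `K = ∫ k`, integration against `k` gains a factor `1 / 2`. This is
what closes both the Grönwall estimate and the contraction argument on the whole interval at once.
-/
theorem integral_mul_exp_integral (hab : a ≤ b) (hk : IntegrableOn k (Icc a b)) :
    IntegrableOn (fun s => k s * Real.exp (2 * ∫ r in a..s, k r)) (Icc a b) ∧
      ∀ t ∈ Icc a b, ∫ s in a..t, k s * Real.exp (2 * ∫ r in a..s, k r)
        = (Real.exp (2 * ∫ r in a..t, k r) - 1) / 2 := by
  have hK : IsPrimitiveOn a b (fun t => 0 + ∫ r in a..t, k r) k := isPrimitiveOn_integral hk 0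
  simp only [zero_add] at hK
  have := ((hK.comp hab (H := fun x => Real.exp (2 * x)) (H' := fun x => Real.exp (2 * x) * 2)
    (fun x => by
      simpa using ((hasDerivAt_id x).const_mul 2).exp) (by fun_prop)).const_mul
        (1 / 2)).congr_right'
    hab (g := fun s => k s * Real.exp (2 * ∫ r in a..s, k r)) (fun s _ => by ring)
  refine ⟨this.1, fun t ht => ?_⟩
  have h := this.2 t ht
  simp only [intervalIntegral.integral_same, mul_zero, Real.exp_zero, mul_one] at h
  linarith

/-- A form of Grönwall's inequality with an integrable kernel. -/
theorem gronwall_integrable {g : ℝ → ℝ} {C : ℝ} (hab : a ≤ b) (hk : IntegrableOn k (Icc a b))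
    (hk0 : ∀ s, 0 ≤ k s) (hg : ContinuousOn g (Icc a b)) (hC : 0 ≤ C)
    (h : ∀ t ∈ Icc a b, g t ≤ C + ∫ s in a..t, k s * g s) :
    ∀ t ∈ Icc a b, g t ≤ 2 * C * Real.exp (2 * ∫ s in a..t, k s) := by
  set K : ℝ → ℝ := fun t => ∫ s in a..t, k s with hKdef
  have hKc : ContinuousOn K (Icc a b) := by
    simpa using (isPrimitiveOn_integral hk 0).continuousOn hab
  obtain ⟨hi, hI⟩ := integral_mul_exp_integral hab hk
  -- At the maximum `m` of `exp (-2 K) g`, the hypothesis reads `m exp (2 K) ≤ C + m (exp (2 K) - 1)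
  -- / 2`, which bounds `m`; the factor `2` in the conclusion is not sharp.
  obtain ⟨t₀, ht₀, hmax⟩ := isCompact_Icc.exists_isMaxOn (nonempty_Icc.2 hab)
    ((Real.continuous_exp.comp_continuousOn (hKc.const_mul (-2))).mul hg)
  set m := Real.exp (-2 * K t₀) * g t₀ with hm
  have hle : ∀ s ∈ Icc a b, g s ≤ m * Real.exp (2 * K s) := fun s hs => by
    have h1 : Real.exp (-2 * K s) * g s ≤ m := hmax hs
    have h2 : Real.exp (-2 * K s) * Real.exp (2 * K s) = 1 := by
      rw [← Real.exp_add]; simp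
    calc g s = Real.exp (-2 * K s) * g s * Real.exp (2 * K s) := by
          rw [mul_right_comm, h2, one_mul]
      _ ≤ _ := by gcongr
  have h3 : ∫ s in a..t₀, k s * g s ≤ m * ((Real.exp (2 * K t₀) - 1) / 2) := by
    rw [← hI t₀ ht₀, ← intervalIntegral.integral_const_mul]
    refine integral_mono_of_le ht₀ (hk.mul_continuousOn hg isCompact_Icc) (hi.const_mul m)
      fun s hs => ?_
    have := mul_le_mul_of_nonneg_left (hle s hs) (hk0 s)
    linarith
  have h4 : g t₀ = m * Real.exp (2 * K t₀) := by
    rw [hm, mul_right_comm, ← Real.exp_add]; simp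
  have hK0 : 0 ≤ K t₀ := intervalIntegral.integral_nonneg ht₀.1 fun s _ => hk0 s
  have h5 : 1 ≤ Real.exp (2 * K t₀) := Real.one_le_exp (by linarith)
  have h6 := h t₀ ht₀
  have h7 : m ≤ 2 * C := by
    by_contra! hcon
    have hmpos : 0 < m := by linarith
    nlinarith
  intro t ht
  exact (hle t ht).trans (by gcongr)

end Kernel

/-- `θ` solves the steering equation `θ' = q cos θ - p sin θ` on `[a, b]`. -/
def IsSteered (a b : ℝ) (p q θ : ℝ → ℝ) : Prop :=
  IsPrimitiveOn a b θ fun s => steer (p s) (q s) (θ s)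

/-- The steering equation with integrable controls has a solution on `[a, b]`. -/
theorem exists_isSteered (hab : a ≤ b) {p q : ℝ → ℝ} (hp : IntegrableOn p (Icc a b))
    (hq : IntegrableOn q (Icc a b)) (θ₀ : ℝ) : ∃ θ, IsSteered a b p q θ ∧ θ a = θ₀ := by
  set k : ℝ → ℝ := fun s => |p s| + |q s| with hk
  have hki : IntegrableOn k (Icc a b) := hp.abs.add hq.abs
  set K : ℝ → ℝ := fun t => ∫ s in a..t, k s with hKdef
  have hKc : ContinuousOn K (Icc a b) := by
    simpa using (isPrimitiveOn_integral hki 0).continuousOn hab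
  obtain ⟨hi, hI⟩ := integral_mul_exp_integral hab hki
  -- The unknown is `z = exp (-2 K) θ`: in this weighted norm the Picard map contracts by `1 / 2`,
  -- however large the controls are.
  let Θ : C(Icc a b, ℝ) → ℝ → ℝ := fun z s => Real.exp (2 * K s) * IccExtend hab z s
  have hΘ : ∀ z, ContinuousOn (Θ z) (Icc a b) := fun z =>
    (Real.continuous_exp.comp_continuousOn (hKc.const_mul 2)).mul
      (z.continuous.Icc_extend' (h := hab)).continuousOn
  let P : C(Icc a b, ℝ) → ℝ → ℝ := fun z t => θ₀ + ∫ s in a..t, steer (p s) (q s) (Θ z s)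
  have hP : ∀ z, ContinuousOn (P z) (Icc a b) := fun z =>
    (isPrimitiveOn_integral (integrableOn_steer hp hq (hΘ z)) θ₀).continuousOn hab
  let T : C(Icc a b, ℝ) → C(Icc a b, ℝ) := fun z =>
    ⟨fun t => Real.exp (-2 * K t) * P z t, continuousOn_iff_continuous_domRestrict.1
      ((Real.continuous_exp.comp_continuousOn (hKc.const_mul (-2))).mul (hP z))⟩
  have hT : ContractingWith (1 / 2) T := by
    refine ⟨by rw [← NNReal.coe_lt_coe]; norm_num, LipschitzWith.of_dist_le_mul fun z z' => ?_⟩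
    rw [ContinuousMap.dist_le (by positivity)]
    rintro ⟨t, ht⟩
    have h1 : |P z t - P z' t| ≤ dist z z' * ((Real.exp (2 * K t) - 1) / 2) := by
      have : P z t - P z' t
          = ∫ s in a..t, (steer (p s) (q s) (Θ z s) - steer (p s) (q s) (Θ z' s)) := by
        rw [intervalIntegral.integral_sub
          (intervalIntegrable_of_integrableOn_Icc (integrableOn_steer hp hq (hΘ z)) ht)
          (intervalIntegrable_of_integrableOn_Icc (integrableOn_steer hp hq (hΘ z')) ht)]
        simp only [P]; ring
      rw [this, ← hI t ht, ← intervalIntegral.integral_const_mul]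
      refine abs_integral_le_of_abs_le ht (hi.const_mul _) fun s hs => ?_
      refine (abs_steer_sub_steer_le _ _ _ _).trans ?_
      have h2 : |Θ z s - Θ z' s| ≤ Real.exp (2 * K s) * dist z z' := by
        simp only [Θ]
        rw [← mul_sub, abs_mul, abs_of_pos (Real.exp_pos _), IccExtend_of_mem _ _ hs,
          IccExtend_of_mem _ _ hs]
        gcongr
        exact ContinuousMap.dist_apply_le_dist (f := z) (g := z') ⟨s, hs⟩
      calc (|p s| + |q s|) * |Θ z s - Θ z' s|
          ≤ (|p s| + |q s|) * (Real.exp (2 * K s) * dist z z') := by gcongr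
        _ = _ := by simp only [hk, hKdef]; ring
    have h3 : dist (T z ⟨t, ht⟩) (T z' ⟨t, ht⟩) = Real.exp (-2 * K t) * |P z t - P z' t| := by
      rw [Real.dist_eq, show T z ⟨t, ht⟩ - T z' ⟨t, ht⟩ = Real.exp (-2 * K t) * P z t
        - Real.exp (-2 * K t) * P z' t from rfl, ← mul_sub, abs_mul, abs_of_pos (Real.exp_pos _)]
    have h4 : Real.exp (-2 * K t) * Real.exp (2 * K t) = 1 := by
      rw [← Real.exp_add]; simp
    rw [h3]
    calc Real.exp (-2 * K t) * |P z t - P z' t|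
        ≤ Real.exp (-2 * K t) * (dist z z' * ((Real.exp (2 * K t) - 1) / 2)) := by gcongr
      _ = dist z z' * (1 - Real.exp (-2 * K t)) / 2 := by linear_combination dist z z' / 2 * h4
      _ ≤ dist z z' * 1 / 2 := by gcongr; linarith [Real.exp_pos (-2 * K t)]
      _ = _ := by push_cast; ring
  set z := ContractingWith.fixedPoint T hT with hz
  have hfix : T z = z := hT.fixedPoint_isFixedPt
  have hfix' : EqOn (P z) (Θ z) (Icc a b) := fun t ht => by
    have h1 : Real.exp (-2 * K t) * P z t = z ⟨t, ht⟩ := DFunLike.congr_fun hfix ⟨t, ht⟩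
    simp only [Θ]
    rw [IccExtend_of_mem _ _ ht, ← h1, ← mul_assoc, ← Real.exp_add]
    simp
  refine ⟨P z, ?_, by simp [P]⟩
  exact (isPrimitiveOn_integral (integrableOn_steer hp hq (hΘ z)) θ₀).congr_right' hab
    fun t ht => by rw [hfix' ht]

/-! ### Dependence of the solution on the control -/

section Perturbation

variable {p q p' q' θ θ' : ℝ → ℝ}

/-- Two solutions of the steering equation with the same initial value differ by at most a multiple
of the `L¹` distance of their controls. -/
theorem IsSteered.abs_sub_le (hab : a ≤ b) (hp : IntegrableOn p (Icc a b))
    (hq : IntegrableOn q (Icc a b)) (hp' : IntegrableOn p' (Icc a b))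
    (hq' : IntegrableOn q' (Icc a b)) (hθ : IsSteered a b p q θ) (hθ' : IsSteered a b p' q' θ')
    (h0 : θ' a = θ a) {t : ℝ} (ht : t ∈ Icc a b) :
    |θ' t - θ t| ≤ 2 * (∫ s in a..b, (|p' s - p s| + |q' s - q s|))
      * Real.exp (2 * ∫ s in a..b, (|p s| + |q s|)) := by
  have hk : IntegrableOn (fun s => |p s| + |q s|) (Icc a b) := hp.abs.add hq.abs
  have hm : IntegrableOn (fun s => |p' s - p s| + |q' s - q s|) (Icc a b) :=
    (hp'.sub hp).abs.add (hq'.sub hq).abs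
  have hd := hθ'.sub hθ
  have hN : 0 ≤ ∫ s in a..b, (|p' s - p s| + |q' s - q s|) :=
    intervalIntegral.integral_nonneg hab fun s _ => by positivity
  have hc := (hd.continuousOn hab).abs
  have hkg := hk.mul_continuousOn hc isCompact_Icc
  refine (gronwall_integrable hab hk (fun s => by positivity) hc hN ?_ t ht).trans ?_
  · intro t ht
    have h1 := hd.2 t ht
    simp only [h0, sub_self, zero_add] at h1
    rw [h1]
    refine (abs_integral_le_of_abs_le ht (hm.add hkg) fun s _ => ?_).trans ?_
    · have e : steer (p' s) (q' s) (θ' s) - steer (p s) (q s) (θ s)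
          = steer (p' s - p s) (q' s - q s) (θ' s)
            + (steer (p s) (q s) (θ' s) - steer (p s) (q s) (θ s)) := by
        simp only [steer]; ring
      rw [e]
      exact (abs_add_le _ _).trans
        (add_le_add (abs_steer_le _ _ _) (abs_steer_sub_steer_le _ _ _ _))
    · simp only [Pi.add_apply]
      rw [intervalIntegral.integral_add (intervalIntegrable_of_integrableOn_Icc hm ht)
        (intervalIntegrable_of_integrableOn_Icc hkg ht)]
      gcongr
      exact integral_mono_right ht hm fun s => by positivity
  · gcongr
    exact integral_mono_right ht hk fun s => by positivity

theorem IsSteered.unique (hab : a ≤ b) (hp : IntegrableOn p (Icc a b))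
    (hq : IntegrableOn q (Icc a b)) (hθ : IsSteered a b p q θ) (hθ' : IsSteered a b p q θ')
    (h0 : θ' a = θ a) {t : ℝ} (ht : t ∈ Icc a b) : θ' t = θ t := by
  have := hθ.abs_sub_le hab hp hq hp hq hθ' h0 ht
  simp only [sub_self, abs_zero, add_zero, intervalIntegral.integral_zero, mul_zero,
    zero_mul] at this
  exact sub_eq_zero.1 (abs_eq_zero.1 (this.antisymm (abs_nonneg _)))

/-- The exponent of the integrating factor of the linearized steering equation along `θ`. -/
def growth (a : ℝ) (p q θ : ℝ → ℝ) (t : ℝ) : ℝ :=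
  ∫ s in a..t, (p s * Real.cos (θ s) + q s * Real.sin (θ s))

theorem isPrimitiveOn_growth (hp : IntegrableOn p (Icc a b)) (hq : IntegrableOn q (Icc a b))
    (hθ : ContinuousOn θ (Icc a b)) : IsPrimitiveOn a b (growth a p q θ)
      (fun s => p s * Real.cos (θ s) + q s * Real.sin (θ s)) := by
  have hi : IntegrableOn (fun s => p s * Real.cos (θ s) + q s * Real.sin (θ s)) (Icc a b) :=
    (hp.mul_continuousOn (Real.continuous_cos.comp_continuousOn hθ) isCompact_Icc).add
      (hq.mul_continuousOn (Real.continuous_sin.comp_continuousOn hθ) isCompact_Icc)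
  exact ⟨hi, fun t _ => by simp [growth]⟩

/-- The solution of the steering equation depends on the control in a differentiable way, with a
quadratic remainder in the `L¹` norm. -/
theorem IsSteered.exists_abs_sub_sub_le (hab : a ≤ b) (hp : IntegrableOn p (Icc a b))
    (hq : IntegrableOn q (Icc a b)) (hθ : IsSteered a b p q θ) :
    ∃ C, ∀ p' q' θ' : ℝ → ℝ, IntegrableOn p' (Icc a b) → IntegrableOn q' (Icc a b) →
      IsSteered a b p' q' θ' → θ' a = θ a →
      |θ' b - θ b - ∫ s in a..b, Real.exp (growth a p q θ s - growth a p q θ b)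
          * steer (p' s - p s) (q' s - q s) (θ s)|
        ≤ C * (∫ s in a..b, (|p' s - p s| + |q' s - q s|)) ^ 2 := by
  have hθc := IsPrimitiveOn.continuousOn hθ hab
  have hA := isPrimitiveOn_growth hp hq hθc
  set A := growth a p q θ with hAdef
  have hA' : IsPrimitiveOn a b (fun t => A t - A b)
      (fun s => p s * Real.cos (θ s) + q s * Real.sin (θ s)) := by
    simpa using hA.sub (isPrimitiveOn_const (A b))
  have hE := hA'.comp hab Real.hasDerivAt_exp Real.continuous_exp
  have hEc := hE.continuousOn hab
  obtain ⟨B, hB⟩ := isCompact_Icc.exists_bound_of_continuousOn hEc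
  have hB0 : 0 ≤ B := (norm_nonneg _).trans (hB a (left_mem_Icc.2 hab))
  have hk : IntegrableOn (fun s => |p s| + |q s|) (Icc a b) := hp.abs.add hq.abs
  set κ := ∫ s in a..b, (|p s| + |q s|) with hκ
  have hbm : b ∈ Icc a b := right_mem_Icc.2 hab
  -- The value of `B (2 κ D² + N D)` divided by `N ^ 2`, where `D = 2 N exp (2 κ)` bounds `|θ' - θ|`
  -- uniformly.
  refine ⟨B * (κ * (2 * (2 * Real.exp (2 * κ)) ^ 2) + 2 * Real.exp (2 * κ)),
    fun p' q' θ' hp' hq' hθ' h0 => ?_⟩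
  have hm : IntegrableOn (fun s => |p' s - p s| + |q' s - q s|) (Icc a b) :=
    (hp'.sub hp).abs.add (hq'.sub hq).abs
  set N := ∫ s in a..b, (|p' s - p s| + |q' s - q s|) with hN
  have hN0 : 0 ≤ N := intervalIntegral.integral_nonneg hab fun s _ => by positivity
  set D := 2 * N * Real.exp (2 * κ) with hD
  have hD0 : 0 ≤ D := by positivity
  have hδ : ∀ t ∈ Icc a b, |θ' t - θ t| ≤ D := fun t ht =>
    hθ.abs_sub_le hab hp hq hp' hq' hθ' h0 ht
  -- The integrating factor is `1` at `b` and `θ' - θ` is `0` at `a`, so integrating the derivative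
  -- of the product yields `θ' b - θ b`.
  have hprod := (hE.mul (hθ'.sub hθ) hab).2 b hbm
  simp only [sub_self, Real.exp_zero, one_mul, h0, mul_zero, zero_add] at hprod
  have hlin : IntegrableOn (fun s => Real.exp (A s - A b)
      * steer (p' s - p s) (q' s - q s) (θ s)) (Icc a b) :=
    IntegrableOn.continuousOn_mul hEc (integrableOn_steer (hp'.sub hp) (hq'.sub hq) hθc)
      isCompact_Icc
  rw [hprod, ← intervalIntegral.integral_sub
    ((hE.mul (hθ'.sub hθ) hab).intervalIntegrable hab)
    (intervalIntegrable_of_integrableOn_Icc hlin hbm)]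
  refine (abs_integral_le_of_abs_le hbm (g := fun s => B * ((|p s| + |q s|) * (2 * D ^ 2)
    + (|p' s - p s| + |q' s - q s|) * D)) ?_ fun s hs => ?_).trans ?_
  · exact ((hk.mul_const _).add (hm.mul_const _)).const_mul _
  -- Once the linear part is removed, what is left is the Taylor remainder in the state, of order `D
  -- ^ 2`, and the mixed change of control and state, of order `D` times the change of control.
  · have e : Real.exp (A s - A b) * (p s * Real.cos (θ s) + q s * Real.sin (θ s)) * (θ' s - θ s)
        + Real.exp (A s - A b) * (steer (p' s) (q' s) (θ' s) - steer (p s) (q s) (θ s))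
        - Real.exp (A s - A b) * steer (p' s - p s) (q' s - q s) (θ s)
        = Real.exp (A s - A b) * ((steer (p s) (q s) (θ' s) - steer (p s) (q s) (θ s)
          + (p s * Real.cos (θ s) + q s * Real.sin (θ s)) * (θ' s - θ s))
          + (steer (p' s - p s) (q' s - q s) (θ' s) - steer (p' s - p s) (q' s - q s) (θ s))) := by
      simp only [steer]; ring
    rw [e, abs_mul]
    have hd := hδ s hs
    refine mul_le_mul (hB s hs) ((abs_add_le _ _).trans (add_le_add ?_ ?_)) (abs_nonneg _) hB0
    · refine (abs_steer_taylor_le _ _ _ _).trans ?_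
      gcongr (|p s| + |q s|) * (2 * ?_)
      rw [← sq_abs]
      gcongr
    · refine (abs_steer_sub_steer_le _ _ _ _).trans ?_
      gcongr
  · refine le_of_eq ?_
    rw [intervalIntegral.integral_const_mul, intervalIntegral.integral_add,
      intervalIntegral.integral_mul_const, intervalIntegral.integral_mul_const, ← hκ, ← hN, hD]
    · ring
    · exact intervalIntegrable_of_integrableOn_Icc (hk.mul_const _) hbm
    · exact intervalIntegrable_of_integrableOn_Icc (hm.mul_const _) hbm

end Perturbation

/-! ### Square integrable controls and the derivative of the endpoint -/

theorem MemLp.integrableOn_Icc {f : ℝ → ℝ} (hf : MemLp f 2 (volume.restrict (Icc a b))) :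
    IntegrableOn f (Icc a b) :=
  hf.integrable one_le_two

theorem memLp_mul_continuousOn {f g : ℝ → ℝ} (hf : MemLp f 2 (volume.restrict (Icc a b)))
    (hg : ContinuousOn g (Icc a b)) :
    MemLp (fun s => f s * g s) 2 (volume.restrict (Icc a b)) := by
  obtain ⟨C, hC⟩ := isCompact_Icc.exists_bound_of_continuousOn hg
  have hgm : MemLp g ⊤ (volume.restrict (Icc a b)) :=
    memLp_top_of_bound (hg.aestronglyMeasurable measurableSet_Icc) C
      ((ae_restrict_iff' measurableSet_Icc).2 (Eventually.of_forall hC))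
  exact hgm.mul (r := 2) hf

theorem memLp_of_continuousOn {g : ℝ → ℝ} (hg : ContinuousOn g (Icc a b)) :
    MemLp g 2 (volume.restrict (Icc a b)) := by
  simpa using memLp_mul_continuousOn (memLp_const (1 : ℝ)) hg

theorem Control.memLp (u : Control a b) (i : Fin 2) :
    MemLp (fun s => u s i) 2 (volume.restrict (Icc a b)) :=
  (Lp.memLp u).eval_piLp i

theorem Control.integrableOn (u : Control a b) (i : Fin 2) :
    IntegrableOn (fun s => u s i) (Icc a b) :=
  MemLp.integrableOn_Icc (Control.memLp u i)

/-- The control with given square integrable components. -/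
def controlOf {f g : ℝ → ℝ} (hf : MemLp f 2 (volume.restrict (Icc a b)))
    (hg : MemLp g 2 (volume.restrict (Icc a b))) : Control a b :=
  MemLp.toLp (fun s => !₂[f s, g s]) (MemLp.of_eval_piLp (p := 2) fun i => by
    fin_cases i
    · exact hf
    · exact hg)

section controlOf

variable {f g : ℝ → ℝ} (hf : MemLp f 2 (volume.restrict (Icc a b)))
  (hg : MemLp g 2 (volume.restrict (Icc a b)))

theorem controlOf_ae : ∀ᵐ s ∂(volume.restrict (Icc a b)),
    controlOf hf hg s 0 = f s ∧ controlOf hf hg s 1 = g s := by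
  filter_upwards [MemLp.coeFn_toLp (f := fun s => !₂[f s, g s]) (p := 2)
    (μ := volume.restrict (Icc a b)) (MemLp.of_eval_piLp (p := 2) fun i => by
      fin_cases i
      · exact hf
      · exact hg)] with s hs
  rw [controlOf, hs]
  simp

theorem inner_controlOf (hab : a ≤ b) (v : Control a b) :
    inner ℝ (controlOf hf hg) v = ∫ s in a..b, (f s * v s 0 + g s * v s 1) := by
  rw [MeasureTheory.L2.inner_def, intervalIntegral.integral_of_le hab,
    ← integral_Icc_eq_integral_Ioc]
  refine integral_congr_ae ?_
  filter_upwards [controlOf_ae hf hg] with s hs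
  simp only [PiLp.inner_apply, Fin.sum_univ_two, hs.1, hs.2, RCLike.inner_apply, conj_trivial]
  ring

end controlOf

/-- Cauchy–Schwarz against the constant control `(1, 1)`. It turns remainders that are quadratic in
the `L¹` norm into remainders quadratic in the `L²` norm. -/
theorem integral_abs_add_abs_le (hab : a ≤ b) (v : Control a b) :
    ∫ s in a..b, (|v s 0| + |v s 1|) ≤
      ‖controlOf (memLp_const (1 : ℝ)) (memLp_const (1 : ℝ)) (a := a) (b := b)‖ * ‖v‖ := by
  have h := controlOf_ae (Control.memLp v 0).abs (Control.memLp v 1).abs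
  set w := controlOf (Control.memLp v 0).abs (Control.memLp v 1).abs with hw
  have h1 : ∫ s in a..b, (|v s 0| + |v s 1|) = inner ℝ
      (controlOf (memLp_const (1 : ℝ)) (memLp_const (1 : ℝ)) (a := a) (b := b)) w := by
    rw [inner_controlOf _ _ hab]
    refine intervalIntegral.integral_congr_ae ?_
    rw [ae_restrict_Icc_iff hab] at h
    filter_upwards [h] with s hs hm
    have := hs (uIoc_subset_uIcc hm)
    rw [this.1, this.2]; simp
  have h2 : ‖w‖ ≤ ‖v‖ := by
    refine Lp.norm_le_norm_of_ae_le ?_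
    filter_upwards [h] with s hs
    rw [EuclideanSpace.norm_eq, EuclideanSpace.norm_eq, Fin.sum_univ_two, Fin.sum_univ_two, hs.1,
      hs.2]
    simp
  rw [h1]
  exact (real_inner_le_norm _ _).trans (by gcongr)

theorem hasFDerivAt_of_quadratic_remainder {E F : Type*} [NormedAddCommGroup E] [NormedSpace ℝ E]
    [NormedAddCommGroup F] [NormedSpace ℝ F] {f : E → F} {L : E →L[ℝ] F} {x : E} {C : ℝ}
    (h : ∀ y, ‖f y - f x - L (y - x)‖ ≤ C * ‖y - x‖ ^ 2) : HasFDerivAt f L x := by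
  rw [hasFDerivAt_iff_isLittleO]
  refine (Asymptotics.IsBigO.of_bound C (Eventually.of_forall fun y => ?_)).trans_isLittleO
    (Asymptotics.isLittleO_pow_sub_sub x one_lt_two)
  rw [norm_pow, norm_norm]
  exact h y

/-- The lift of the angle of a link of length `ℓ` along the path steered by the control `u`. -/
def liftAngle (hab : a ≤ b) (ℓ θ₀ : ℝ) (u : Control a b) : ℝ → ℝ :=
  Classical.choose (exists_isSteered hab ((Control.integrableOn u 0).div_const ℓ)
    ((Control.integrableOn u 1).div_const ℓ) θ₀)

theorem isSteered_liftAngle (hab : a ≤ b) (ℓ θ₀ : ℝ) (u : Control a b) :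
    IsSteered a b (fun s => u s 0 / ℓ) (fun s => u s 1 / ℓ) (liftAngle hab ℓ θ₀ u) :=
  (Classical.choose_spec (exists_isSteered hab ((Control.integrableOn u 0).div_const ℓ)
    ((Control.integrableOn u 1).div_const ℓ) θ₀)).1

theorem liftAngle_left (hab : a ≤ b) (ℓ θ₀ : ℝ) (u : Control a b) :
    liftAngle hab ℓ θ₀ u a = θ₀ :=
  (Classical.choose_spec (exists_isSteered hab ((Control.integrableOn u 0).div_const ℓ)
    ((Control.integrableOn u 1).div_const ℓ) θ₀)).2

theorem continuousOn_liftAngle (hab : a ≤ b) (ℓ θ₀ : ℝ) (u : Control a b) :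
    ContinuousOn (liftAngle hab ℓ θ₀ u) (Icc a b) :=
  IsPrimitiveOn.continuousOn (isSteered_liftAngle hab ℓ θ₀ u) hab

/-- The exponent of the integrating factor of the linearization along the path steered by `u`. -/
def liftGrowth (hab : a ≤ b) (ℓ θ₀ : ℝ) (u : Control a b) : ℝ → ℝ :=
  growth a (fun s => u s 0 / ℓ) (fun s => u s 1 / ℓ) (liftAngle hab ℓ θ₀ u)

theorem isPrimitiveOn_liftGrowth (hab : a ≤ b) (ℓ θ₀ : ℝ) (u : Control a b) :
    IsPrimitiveOn a b (liftGrowth hab ℓ θ₀ u) (fun s => u s 0 / ℓ *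
      Real.cos (liftAngle hab ℓ θ₀ u s) + u s 1 / ℓ * Real.sin (liftAngle hab ℓ θ₀ u s)) :=
  isPrimitiveOn_growth ((Control.integrableOn u 0).div_const ℓ)
    ((Control.integrableOn u 1).div_const ℓ) (continuousOn_liftAngle hab ℓ θ₀ u)

/-- The first component of the gradient of the final angle. -/
def angleGrad₁ (hab : a ≤ b) (ℓ θ₀ : ℝ) (u : Control a b) (s : ℝ) : ℝ :=
  -(Real.exp (liftGrowth hab ℓ θ₀ u s - liftGrowth hab ℓ θ₀ u b)
    * Real.sin (liftAngle hab ℓ θ₀ u s) / ℓ)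

/-- The second component of the gradient of the final angle. -/
def angleGrad₂ (hab : a ≤ b) (ℓ θ₀ : ℝ) (u : Control a b) (s : ℝ) : ℝ :=
  Real.exp (liftGrowth hab ℓ θ₀ u s - liftGrowth hab ℓ θ₀ u b)
    * Real.cos (liftAngle hab ℓ θ₀ u s) / ℓ

theorem continuousOn_exp_liftGrowth (hab : a ≤ b) (ℓ θ₀ : ℝ) (u : Control a b) :
    ContinuousOn (fun s => Real.exp (liftGrowth hab ℓ θ₀ u s - liftGrowth hab ℓ θ₀ u b))
      (Icc a b) :=
  Real.continuous_exp.comp_continuousOn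
    (((isPrimitiveOn_liftGrowth hab ℓ θ₀ u).continuousOn hab).sub continuousOn_const)

theorem continuousOn_angleGrad₁ (hab : a ≤ b) (ℓ θ₀ : ℝ) (u : Control a b) :
    ContinuousOn (angleGrad₁ hab ℓ θ₀ u) (Icc a b) :=
  (((continuousOn_exp_liftGrowth hab ℓ θ₀ u).mul
    (Real.continuous_sin.comp_continuousOn (continuousOn_liftAngle hab ℓ θ₀ u))).div_const ℓ).neg

theorem continuousOn_angleGrad₂ (hab : a ≤ b) (ℓ θ₀ : ℝ) (u : Control a b) :
    ContinuousOn (angleGrad₂ hab ℓ θ₀ u) (Icc a b) :=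
  ((continuousOn_exp_liftGrowth hab ℓ θ₀ u).mul
    (Real.continuous_cos.comp_continuousOn (continuousOn_liftAngle hab ℓ θ₀ u))).div_const ℓ

/-- The gradient of the final angle as a function of the control. -/
def angleGrad (hab : a ≤ b) (ℓ θ₀ : ℝ) (u : Control a b) : Control a b :=
  controlOf (memLp_of_continuousOn (continuousOn_angleGrad₁ hab ℓ θ₀ u))
    (memLp_of_continuousOn (continuousOn_angleGrad₂ hab ℓ θ₀ u))

theorem hasFDerivAt_liftAngle (hab : a ≤ b) {ℓ : ℝ} (hℓ : 0 < ℓ) (θ₀ : ℝ) (u : Control a b) :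
    HasFDerivAt (fun v => liftAngle hab ℓ θ₀ v b) (innerSL ℝ (angleGrad hab ℓ θ₀ u)) u := by
  obtain ⟨C, hC⟩ := (isSteered_liftAngle hab ℓ θ₀ u).exists_abs_sub_sub_le hab
    ((Control.integrableOn u 0).div_const ℓ) ((Control.integrableOn u 1).div_const ℓ)
  set c := ‖controlOf (memLp_const (1 : ℝ)) (memLp_const (1 : ℝ)) (a := a) (b := b)‖
  -- The absolute value is needed because nothing is known about the sign of `C`.
  refine hasFDerivAt_of_quadratic_remainder (C := |C| * (c / ℓ) ^ 2) fun v => ?_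
  have h := hC _ _ _ ((Control.integrableOn v 0).div_const ℓ)
    ((Control.integrableOn v 1).div_const ℓ) (isSteered_liftAngle hab ℓ θ₀ v)
    (by rw [liftAngle_left, liftAngle_left])
  have hsub : ∀ᵐ s, s ∈ uIcc a b → (v - u) s = v s - u s :=
    (ae_restrict_Icc_iff hab).1 (Lp.coeFn_sub v u)
  have h1 : innerSL ℝ (angleGrad hab ℓ θ₀ u) (v - u) = ∫ s in a..b,
      Real.exp (liftGrowth hab ℓ θ₀ u s - liftGrowth hab ℓ θ₀ u b) *
        steer (v s 0 / ℓ - u s 0 / ℓ) (v s 1 / ℓ - u s 1 / ℓ) (liftAngle hab ℓ θ₀ u s) := by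
    rw [innerSL_apply_apply, angleGrad, inner_controlOf _ _ hab]
    refine intervalIntegral.integral_congr_ae ?_
    filter_upwards [hsub] with s hs hm
    rw [hs (uIoc_subset_uIcc hm)]
    simp only [angleGrad₁, angleGrad₂, steer, PiLp.sub_apply]
    ring
  have h2 : ∫ s in a..b, (|v s 0 / ℓ - u s 0 / ℓ| + |v s 1 / ℓ - u s 1 / ℓ|)
      = (∫ s in a..b, (|(v - u) s 0| + |(v - u) s 1|)) / ℓ := by
    rw [← intervalIntegral.integral_div]
    refine intervalIntegral.integral_congr_ae ?_
    filter_upwards [hsub] with s hs hm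
    rw [hs (uIoc_subset_uIcc hm), PiLp.sub_apply, PiLp.sub_apply, ← sub_div, ← sub_div, abs_div,
      abs_div, abs_of_pos hℓ, add_div]
  have h3 := integral_abs_add_abs_le hab (v - u)
  have h4 : 0 ≤ ∫ s in a..b, (|(v - u) s 0| + |(v - u) s 1|) :=
    intervalIntegral.integral_nonneg hab fun s _ => by positivity
  rw [h1, Real.norm_eq_abs]
  refine h.trans ?_
  rw [h2]
  calc C * ((∫ s in a..b, (|(v - u) s 0| + |(v - u) s 1|)) / ℓ) ^ 2
      ≤ |C| * (c * ‖v - u‖ / ℓ) ^ 2 := by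
        gcongr
        exact le_abs_self C
    _ = _ := by ring

/-- The displacement in the universal cover of the end of the path steered by `u`. -/
def displacement (hab : a ≤ b) (ℓ₁ ℓ₂ θ₁ θ₂ : ℝ) (u : Control a b) : Vec :=
  (∫ s in a..b, u s 0, ∫ s in a..b, u s 1, liftAngle hab ℓ₁ θ₁ u b - θ₁,
    liftAngle hab ℓ₂ θ₂ u b - θ₂)

/-- The derivative of the displacement. -/
def displacementDeriv (hab : a ≤ b) (ℓ₁ ℓ₂ θ₁ θ₂ : ℝ) (u : Control a b) : Control a b →L[ℝ] Vec :=
  (innerSL ℝ (controlOf (memLp_const (1 : ℝ)) (memLp_const (0 : ℝ)))).prod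
    ((innerSL ℝ (controlOf (memLp_const (0 : ℝ)) (memLp_const (1 : ℝ)))).prod
      ((innerSL ℝ (angleGrad hab ℓ₁ θ₁ u)).prod (innerSL ℝ (angleGrad hab ℓ₂ θ₂ u))))

theorem hasFDerivAt_displacement (hab : a ≤ b) {ℓ₁ ℓ₂ : ℝ} (h₁ : 0 < ℓ₁) (h₂ : 0 < ℓ₂)
    (θ₁ θ₂ : ℝ) (u : Control a b) :
    HasFDerivAt (displacement hab ℓ₁ ℓ₂ θ₁ θ₂) (displacementDeriv hab ℓ₁ ℓ₂ θ₁ θ₂ u) u := by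
  have e0 : (fun v : Control a b => ∫ s in a..b, v s 0)
      = innerSL ℝ (controlOf (memLp_const (1 : ℝ)) (memLp_const (0 : ℝ))) := by
    ext v; rw [innerSL_apply_apply, inner_controlOf _ _ hab]; simp
  have e1 : (fun v : Control a b => ∫ s in a..b, v s 1)
      = innerSL ℝ (controlOf (memLp_const (0 : ℝ)) (memLp_const (1 : ℝ))) := by
    ext v; rw [innerSL_apply_apply, inner_controlOf _ _ hab]; simp
  refine HasFDerivAt.prodMk ?_ (HasFDerivAt.prodMk ?_ (HasFDerivAt.prodMk ?_ ?_))
  · rw [e0]; exact ContinuousLinearMap.hasFDerivAt _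
  · rw [e1]; exact ContinuousLinearMap.hasFDerivAt _
  · exact (hasFDerivAt_liftAngle hab h₁ θ₁ u).sub_const _
  · exact (hasFDerivAt_liftAngle hab h₂ θ₂ u).sub_const _

/-! ### The covering map and lifts of horizontal paths -/

theorem cover_add (v w : Vec) : cover (v + w) = cover v + cover w := by
  simp [cover]

theorem cover_sub (v w : Vec) : cover (v - w) = cover v - cover w := by
  simp [cover]

theorem cover_surjective : Function.Surjective cover := by
  rintro ⟨x, y, α, β⟩
  induction α using Real.Angle.induction_on with | _ α
  induction β using Real.Angle.induction_on with | _ β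
  exact ⟨(x, y, α, β), rfl⟩

theorem continuous_cover : Continuous cover := by
  unfold cover; fun_prop

theorem eq_of_angle_coe_eq {x y : ℝ} (h : (x : Real.Angle) = y) (hlt : |x - y| < 2 * Real.pi) :
    x = y := by
  obtain ⟨k, hk⟩ := Real.Angle.angle_eq_iff_two_pi_dvd_sub.1 h
  rw [hk, abs_mul, abs_of_pos Real.two_pi_pos] at hlt
  have h1 : |(k : ℝ)| < 1 := by
    by_contra! hc
    nlinarith [Real.two_pi_pos]
  have h2 : k = 0 := by
    rw [← Int.cast_abs] at h1
    exact Int.abs_lt_one_iff.1 (by exact_mod_cast h1)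
  rw [h2] at hk
  simp only [Int.cast_zero, mul_zero] at hk
  linarith

theorem eq_of_cover_eq {v w : Vec} (h : cover v = cover w) (hlt : ‖v - w‖ < 2 * Real.pi) :
    v = w := by
  obtain ⟨x, y, α, β⟩ := v
  obtain ⟨x', y', α', β'⟩ := w
  simp only [cover, Prod.mk.injEq] at h
  simp only [Prod.mk_sub_mk, Prod.norm_mk, sup_lt_iff, Real.norm_eq_abs] at hlt
  obtain ⟨rfl, rfl, h3, h4⟩ := h
  rw [eq_of_angle_coe_eq h3 hlt.2.2.1, eq_of_angle_coe_eq h4 hlt.2.2.2]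

/-- The integral of a `Vec`-valued function is computed componentwise. -/
theorem integral_vec {w : ℝ → Vec} {s t : ℝ} (hw : IntervalIntegrable w volume s t) :
    ∫ r in s..t, w r = (∫ r in s..t, (w r).1, ∫ r in s..t, (w r).2.1, ∫ r in s..t, (w r).2.2.1,
      ∫ r in s..t, (w r).2.2.2) := by
  have key : ∀ L : Vec →L[ℝ] ℝ, L (∫ r in s..t, w r) = ∫ r in s..t, L (w r) := fun L =>
    (L.intervalIntegral_comp_comm hw).symm
  refine Prod.ext (key (.fst ℝ _ _)) (Prod.ext
    (key ((ContinuousLinearMap.fst ℝ _ _).comp (.snd ℝ _ _))) (Prod.ext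
    (key ((ContinuousLinearMap.fst ℝ _ _).comp ((ContinuousLinearMap.snd ℝ _ _).comp
      (.snd ℝ _ _)))) (key ((ContinuousLinearMap.snd ℝ _ _).comp
      ((ContinuousLinearMap.snd ℝ _ _).comp (.snd ℝ _ _))))))

theorem memLp_vec_iff {w : ℝ → Vec} : MemLp w 2 (volume.restrict (Icc a b)) ↔
    MemLp (fun s => (w s).1) 2 (volume.restrict (Icc a b)) ∧
    MemLp (fun s => (w s).2.1) 2 (volume.restrict (Icc a b)) ∧
    MemLp (fun s => (w s).2.2.1) 2 (volume.restrict (Icc a b)) ∧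
    MemLp (fun s => (w s).2.2.2) 2 (volume.restrict (Icc a b)) := by
  rw [memLp_prod_iff, memLp_prod_iff, memLp_prod_iff]

theorem intervalIntegrable_of_memLp {E : Type*} [NormedAddCommGroup E] {w : ℝ → E}
    (hw : MemLp w 2 (volume.restrict (Icc a b))) {t : ℝ} (ht : t ∈ Icc a b) :
    IntervalIntegrable w volume a t := by
  rw [intervalIntegrable_iff_integrableOn_Icc_of_le ht.1]
  have : IntegrableOn w (Icc a b) := hw.integrable one_le_two
  exact this.mono_set (Icc_subset_Icc_right ht.2)

theorem velocity_eq (ℓ₁ ℓ₂ c d x y θ₁ θ₂ : ℝ) :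
    c • v₁ ℓ₁ ℓ₂ (cover (x, y, θ₁, θ₂)) + d • v₂ ℓ₁ ℓ₂ (cover (x, y, θ₁, θ₂))
      = (c, d, steer (c / ℓ₁) (d / ℓ₁) θ₁, steer (c / ℓ₂) (d / ℓ₂) θ₂) := by
  simp only [v₁, v₂, cover, steer, Real.Angle.sin_coe, Real.Angle.cos_coe, Prod.smul_mk,
    Prod.mk_add_mk, smul_eq_mul, Prod.mk.injEq]
  refine ⟨by ring, by ring, by ring, by ring⟩

/-- The lift to the universal cover of the path that starts at `cover z` and is steered by `u`. -/
def liftPath (hab : a ≤ b) (ℓ₁ ℓ₂ : ℝ) (z : Vec) (u : Control a b) (t : ℝ) : Vec :=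
  (z.1 + ∫ s in a..t, u s 0, z.2.1 + ∫ s in a..t, u s 1, liftAngle hab ℓ₁ z.2.2.1 u t,
    liftAngle hab ℓ₂ z.2.2.2 u t)

theorem liftPath_left (hab : a ≤ b) (ℓ₁ ℓ₂ : ℝ) (z : Vec) (u : Control a b) :
    liftPath hab ℓ₁ ℓ₂ z u a = z := by
  simp [liftPath, liftAngle_left]

theorem liftPath_right (hab : a ≤ b) (ℓ₁ ℓ₂ : ℝ) (z : Vec) (u : Control a b) :
    liftPath hab ℓ₁ ℓ₂ z u b = z + displacement hab ℓ₁ ℓ₂ z.2.2.1 z.2.2.2 u := by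
  simp [liftPath, displacement, Prod.ext_iff]

theorem memLp_steer {p q θ : ℝ → ℝ} (hp : MemLp p 2 (volume.restrict (Icc a b)))
    (hq : MemLp q 2 (volume.restrict (Icc a b))) (hθ : ContinuousOn θ (Icc a b)) :
    MemLp (fun s => steer (p s) (q s) (θ s)) 2 (volume.restrict (Icc a b)) :=
  (memLp_mul_continuousOn hq (Real.continuous_cos.comp_continuousOn hθ)).sub
    (memLp_mul_continuousOn hp (Real.continuous_sin.comp_continuousOn hθ))

theorem Control.memLp_div (u : Control a b) (i : Fin 2) (ℓ : ℝ) :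
    MemLp (fun s => u s i / ℓ) 2 (volume.restrict (Icc a b)) := by
  simpa [div_eq_mul_inv] using (Control.memLp u i).mul_const ℓ⁻¹

theorem velocity_ae_congr {f g : ℝ → Vec} (h : EqOn f g (Icc a b)) :
    f =ᵐ[volume.restrict (Icc a b)] g :=
  (ae_restrict_iff' measurableSet_Icc).2 (Eventually.of_forall h)

theorem integral_congr_Icc {E : Type*} [NormedAddCommGroup E] [NormedSpace ℝ E] {f g : ℝ → E}
    (h : EqOn f g (Icc a b)) {t : ℝ} (ht : t ∈ Icc a b) :
    ∫ s in a..t, f s = ∫ s in a..t, g s := by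
  refine intervalIntegral.integral_congr ?_
  rw [uIcc_of_le ht.1]
  exact h.mono (Icc_subset_Icc_right ht.2)

/-- A curve is steered by `u` if and only if it is the projection of the lifted path of `u`. -/
theorem isControlledBy_iff (hab : a ≤ b) {ℓ₁ ℓ₂ : ℝ} {γ : ℝ → Pos} {z : Vec} (u : Control a b)
    (h0 : γ a = cover z) : IsControlledBy ℓ₁ ℓ₂ a b γ u ↔
      ∀ t ∈ Icc a b, γ t = cover (liftPath hab ℓ₁ ℓ₂ z u t) := by
  obtain ⟨x, y, θ₁, θ₂⟩ := z
  constructor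
  · rintro ⟨hw, hγ⟩
    set w : ℝ → Vec := fun s => u s 0 • v₁ ℓ₁ ℓ₂ (γ s) + u s 1 • v₂ ℓ₁ ℓ₂ (γ s) with hwdef
    -- Integrating the velocity in `ℝ⁴` lifts `γ`. The lifted angles solve the steering equations,
    -- so uniqueness identifies them with `liftAngle`.
    set ψ : ℝ → Vec := fun t => (x + ∫ s in a..t, (w s).1, y + ∫ s in a..t, (w s).2.1,
      θ₁ + ∫ s in a..t, (w s).2.2.1, θ₂ + ∫ s in a..t, (w s).2.2.2) with hψ
    have hγψ : ∀ t ∈ Icc a b, γ t = cover (ψ t) := fun t ht => by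
      rw [hγ t ht, h0, integral_vec (intervalIntegrable_of_memLp hw ht), ← cover_add]
      rfl
    have hwψ : EqOn w (fun s => (u s 0, u s 1, steer (u s 0 / ℓ₁) (u s 1 / ℓ₁) (ψ s).2.2.1,
        steer (u s 0 / ℓ₂) (u s 1 / ℓ₂) (ψ s).2.2.2)) (Icc a b) := fun s hs => by
      simp only [hwdef]
      rw [hγψ s hs, velocity_eq]
    obtain ⟨-, -, hm3, hm4⟩ := memLp_vec_iff.1 hw
    have hS1 : IsSteered a b (fun s => u s 0 / ℓ₁) (fun s => u s 1 / ℓ₁) fun t => (ψ t).2.2.1 :=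
      (isPrimitiveOn_integral (MemLp.integrableOn_Icc hm3) θ₁).congr_right' hab
        fun s hs => by beta_reduce; rw [hwψ hs]
    have hS2 : IsSteered a b (fun s => u s 0 / ℓ₂) (fun s => u s 1 / ℓ₂) fun t => (ψ t).2.2.2 :=
      (isPrimitiveOn_integral (MemLp.integrableOn_Icc hm4) θ₂).congr_right' hab
        fun s hs => by beta_reduce; rw [hwψ hs]
    intro t ht
    rw [hγψ t ht]
    congr 1
    refine Prod.ext ?_ (Prod.ext ?_ (Prod.ext ?_ ?_))
    · simp only [hψ, liftPath]
      rw [integral_congr_Icc (fun s hs => by rw [hwψ hs]) ht]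
    · simp only [hψ, liftPath]
      rw [integral_congr_Icc (fun s hs => by rw [hwψ hs]) ht]
    · exact (isSteered_liftAngle hab ℓ₁ θ₁ u).unique hab ((Control.integrableOn u 0).div_const ℓ₁)
        ((Control.integrableOn u 1).div_const ℓ₁) hS1 (by simp [hψ, liftAngle_left]) ht
    · exact (isSteered_liftAngle hab ℓ₂ θ₂ u).unique hab ((Control.integrableOn u 0).div_const ℓ₂)
        ((Control.integrableOn u 1).div_const ℓ₂) hS2 (by simp [hψ, liftAngle_left]) ht
  · intro hγ
    have hw : EqOn (fun s => u s 0 • v₁ ℓ₁ ℓ₂ (γ s) + u s 1 • v₂ ℓ₁ ℓ₂ (γ s))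
        (fun s => (u s 0, u s 1,
          steer (u s 0 / ℓ₁) (u s 1 / ℓ₁) (liftAngle hab ℓ₁ θ₁ u s),
          steer (u s 0 / ℓ₂) (u s 1 / ℓ₂) (liftAngle hab ℓ₂ θ₂ u s))) (Icc a b) := fun s hs => by
      beta_reduce
      rw [hγ s hs, liftPath, velocity_eq]
    have hm : MemLp (fun s => (u s 0, u s 1,
          steer (u s 0 / ℓ₁) (u s 1 / ℓ₁) (liftAngle hab ℓ₁ θ₁ u s),
          steer (u s 0 / ℓ₂) (u s 1 / ℓ₂) (liftAngle hab ℓ₂ θ₂ u s))) 2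
          (volume.restrict (Icc a b)) :=
      memLp_vec_iff.2 ⟨Control.memLp u 0, Control.memLp u 1,
        memLp_steer (Control.memLp_div u 0 ℓ₁) (Control.memLp_div u 1 ℓ₁)
          (continuousOn_liftAngle hab ℓ₁ θ₁ u),
        memLp_steer (Control.memLp_div u 0 ℓ₂) (Control.memLp_div u 1 ℓ₂)
          (continuousOn_liftAngle hab ℓ₂ θ₂ u)⟩
    refine ⟨hm.ae_eq (velocity_ae_congr hw).symm, fun t ht => ?_⟩
    rw [integral_congr_Icc hw ht, integral_vec (intervalIntegrable_of_memLp hm ht), hγ t ht, h0,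
      ← cover_add]
    congr 1
    have e1 := (isSteered_liftAngle hab ℓ₁ θ₁ u).2 t ht
    have e2 := (isSteered_liftAngle hab ℓ₂ θ₂ u).2 t ht
    rw [liftAngle_left] at e1 e2
    simp only [liftPath, Prod.mk_add_mk, Prod.mk.injEq, true_and]
    exact ⟨e1, e2⟩

theorem IsControlledBy.isHorizontal {ℓ₁ ℓ₂ : ℝ} (h₁ : 0 < ℓ₁) (h₂ : 0 < ℓ₂) {γ : ℝ → Pos}
    {u : Control a b} (h : IsControlledBy ℓ₁ ℓ₂ a b γ u) : IsHorizontal ℓ₁ ℓ₂ a b γ :=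
  ⟨_, h, Eventually.of_forall fun s => by
    rw [mem_distribution_iff h₁ h₂]
    simp [v₁, v₂]⟩

/-- A control and an initial point determine the path on `[a, b]`, so there is exactly one endpoint
map, and it has an explicit lift. -/
theorem isEndpointMap_iff (hab : a ≤ b) {ℓ₁ ℓ₂ : ℝ} {z : Vec} {E : Control a b → Pos} :
    IsEndpointMap ℓ₁ ℓ₂ a b (cover z) E ↔
      ∀ u, E u = cover z + cover (displacement hab ℓ₁ ℓ₂ z.2.2.1 z.2.2.2 u) := by
  refine forall_congr' fun u => ⟨?_, fun h => ?_⟩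
  · rintro ⟨η, hη, h0, hb⟩
    rw [← hb, (isControlledBy_iff hab u h0).1 hη b (right_mem_Icc.2 hab), liftPath_right, cover_add]
  · refine ⟨fun t => cover (liftPath hab ℓ₁ ℓ₂ z u t), ?_, by beta_reduce; rw [liftPath_left], ?_⟩
    · exact (isControlledBy_iff hab u (by rw [liftPath_left])).2 fun t _ => rfl
    · beta_reduce
      rw [liftPath_right, cover_add, h]

/-- The differential of a map with a differentiable lift is the derivative of the lift. -/
theorem hasDifferentialAt_iff {F : Type*} [NormedAddCommGroup F] [NormedSpace ℝ F] {f : F → Pos}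
    {q : Pos} {Δ : F → Vec} {L L' : F →L[ℝ] Vec} {x : F} (hf : ∀ y, f y = q + cover (Δ y))
    (hΔ : HasFDerivAt Δ L' x) : HasDifferentialAt f L x ↔ L = L' := by
  constructor
  · rintro ⟨δ, hδ0, hδ, hev⟩
    have hc : Tendsto (fun y => ‖δ y - (Δ y - Δ x)‖) (𝓝 x) (𝓝 0) := by
      have := ContinuousAt.norm (f := fun y => δ y - (Δ y - Δ x))
        (hδ.continuousAt.sub (hΔ.continuousAt.sub continuousAt_const))
      simpa [ContinuousAt, hδ0] using this
    -- Both local lifts vanish at `x`. Near `x` they differ by a period of the covering of norm less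
    -- than `2π`, hence not at all.
    have he : δ =ᶠ[𝓝 x] fun y => Δ y - Δ x := by
      filter_upwards [hev, hc.eventually_lt_const Real.two_pi_pos] with y hy hlt
      refine eq_of_cover_eq ?_ hlt
      rw [hf y, hf x, add_assoc] at hy
      rw [cover_sub, add_left_cancel hy]
      abel
    exact hδ.unique ((hΔ.sub_const _).congr_of_eventuallyEq he)
  · rintro rfl
    refine ⟨fun y => Δ y - Δ x, sub_self _, hΔ.sub_const _, Eventually.of_forall fun y => ?_⟩
    rw [hf y, hf x, cover_sub]
    abel

theorem isSingular_iff_not_surjective (hab : a ≤ b) {ℓ₁ ℓ₂ : ℝ} (h₁ : 0 < ℓ₁) (h₂ : 0 < ℓ₂)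
    {γ : ℝ → Pos} {z : Vec} (h0 : γ a = cover z) : IsSingular ℓ₁ ℓ₂ a b γ ↔
      ∃ u, IsControlledBy ℓ₁ ℓ₂ a b γ u ∧
        ¬ Function.Surjective (displacementDeriv hab ℓ₁ ℓ₂ z.2.2.1 z.2.2.2 u) := by
  constructor
  · rintro ⟨-, u, hu, E, hE, L, hL, hs⟩
    rw [h0, isEndpointMap_iff hab] at hE
    rw [hasDifferentialAt_iff hE (hasFDerivAt_displacement hab h₁ h₂ _ _ u)] at hL
    exact ⟨u, hu, hL ▸ hs⟩
  · rintro ⟨u, hu, hs⟩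
    refine ⟨hu.isHorizontal h₁ h₂, u, hu,
      fun v => cover z + cover (displacement hab ℓ₁ ℓ₂ z.2.2.1 z.2.2.2 v), ?_, _, ?_, hs⟩
    · rw [h0, isEndpointMap_iff hab]
      exact fun _ => rfl
    · exact (hasDifferentialAt_iff (fun _ => rfl)
        (hasFDerivAt_displacement hab h₁ h₂ _ _ u)).2 rfl

/-! ### Annihilating covectors and the pointwise criterion -/

section Covector

variable {ℓ₁ ℓ₂ θ₁ θ₂ : ℝ} {u : Control a b}

/-- The differential of the endpoint map is not surjective if and only if some nonzero covector,
transported along the path, annihilates the distribution. -/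
theorem not_surjective_iff (hab : a < b) :
    ¬ Function.Surjective (displacementDeriv hab.le ℓ₁ ℓ₂ θ₁ θ₂ u) ↔
      ∃ p : Vec, p ≠ 0 ∧ ∀ s ∈ Icc a b,
        p.1 + p.2.2.1 * angleGrad₁ hab.le ℓ₁ θ₁ u s + p.2.2.2 * angleGrad₁ hab.le ℓ₂ θ₂ u s = 0 ∧
        p.2.1 + p.2.2.1 * angleGrad₂ hab.le ℓ₁ θ₁ u s + p.2.2.2 * angleGrad₂ hab.le ℓ₂ θ₂ u s
          = 0 := by
  set L := displacementDeriv hab.le ℓ₁ ℓ₂ θ₁ θ₂ u with hL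
  set G₁ := angleGrad₁ hab.le ℓ₁ θ₁ u with hG₁
  set G₂ := angleGrad₂ hab.le ℓ₁ θ₁ u with hG₂
  set H₁ := angleGrad₁ hab.le ℓ₂ θ₂ u with hH₁
  set H₂ := angleGrad₂ hab.le ℓ₂ θ₂ u with hH₂
  have cG₁ : ContinuousOn G₁ (Icc a b) := continuousOn_angleGrad₁ hab.le ℓ₁ θ₁ u
  have cG₂ : ContinuousOn G₂ (Icc a b) := continuousOn_angleGrad₂ hab.le ℓ₁ θ₁ u
  have cH₁ : ContinuousOn H₁ (Icc a b) := continuousOn_angleGrad₁ hab.le ℓ₂ θ₂ u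
  have cH₂ : ContinuousOn H₂ (Icc a b) := continuousOn_angleGrad₂ hab.le ℓ₂ θ₂ u
  have m1 : MemLp (fun _ => (1 : ℝ)) 2 (volume.restrict (Icc a b)) := memLp_const 1
  have m0 : MemLp (fun _ => (0 : ℝ)) 2 (volume.restrict (Icc a b)) := memLp_const 0
  -- `R` is the adjoint of `L`: a covector annihilates the range of `L` if and only if `R p = 0`.
  let R : Vec → Control a b := fun p => p.1 • controlOf m1 m0 + p.2.1 • controlOf m0 m1
    + p.2.2.1 • angleGrad hab.le ℓ₁ θ₁ u + p.2.2.2 • angleGrad hab.le ℓ₂ θ₂ u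
  have hR : ∀ p v, inner ℝ (R p) v = p.1 * (L v).1 + p.2.1 * (L v).2.1 + p.2.2.1 * (L v).2.2.1
      + p.2.2.2 * (L v).2.2.2 := fun p v => by
    simp only [R, inner_add_left, real_inner_smul_left]
    rfl
  have hRae : ∀ p, ∀ᵐ s ∂(volume.restrict (Icc a b)),
      R p s 0 = p.1 + p.2.2.1 * G₁ s + p.2.2.2 * H₁ s ∧
      R p s 1 = p.2.1 + p.2.2.1 * G₂ s + p.2.2.2 * H₂ s := fun p => by
    filter_upwards [Lp.coeFn_add (p.1 • controlOf m1 m0 + p.2.1 • controlOf m0 m1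
        + p.2.2.1 • angleGrad hab.le ℓ₁ θ₁ u) (p.2.2.2 • angleGrad hab.le ℓ₂ θ₂ u),
      Lp.coeFn_add (p.1 • controlOf m1 m0 + p.2.1 • controlOf m0 m1)
        (p.2.2.1 • angleGrad hab.le ℓ₁ θ₁ u),
      Lp.coeFn_add (p.1 • controlOf m1 m0) (p.2.1 • controlOf m0 m1),
      Lp.coeFn_smul p.1 (controlOf m1 m0), Lp.coeFn_smul p.2.1 (controlOf m0 m1),
      Lp.coeFn_smul p.2.2.1 (angleGrad hab.le ℓ₁ θ₁ u),
      Lp.coeFn_smul p.2.2.2 (angleGrad hab.le ℓ₂ θ₂ u), controlOf_ae m1 m0, controlOf_ae m0 m1,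
      controlOf_ae (memLp_of_continuousOn cG₁) (memLp_of_continuousOn cG₂),
      controlOf_ae (memLp_of_continuousOn cH₁) (memLp_of_continuousOn cH₂)]
      with s e1 e2 e3 e4 e5 e6 e7 e8 e9 e10 e11
    simp only [R]
    rw [e1, Pi.add_apply, e2, Pi.add_apply, e3, Pi.add_apply, e4, e5, e6, e7]
    simp only [Pi.smul_apply, PiLp.add_apply, PiLp.smul_apply, smul_eq_mul, angleGrad]
    rw [e8.1, e8.2, e9.1, e9.2, e10.1, e10.2, e11.1, e11.2]
    exact ⟨by ring, by ring⟩
  constructor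
  · intro hs
    have hlt : L.toLinearMap.range < ⊤ := by
      rw [lt_top_iff_ne_top, Ne, LinearMap.range_eq_top]
      exact hs
    obtain ⟨f, hf0, hf⟩ := Submodule.exists_le_ker_of_lt_top _ hlt
    have hfp : ∀ w : Vec, f w = f (1, 0, 0, 0) * w.1 + f (0, 1, 0, 0) * w.2.1
        + f (0, 0, 1, 0) * w.2.2.1 + f (0, 0, 0, 1) * w.2.2.2 := fun w => by
      obtain ⟨w1, w2, w3, w4⟩ := w
      have : ((w1, w2, w3, w4) : Vec) = w1 • (1, 0, 0, 0) + w2 • (0, 1, 0, 0) + w3 • (0, 0, 1, 0)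
          + w4 • (0, 0, 0, 1) := by simp
      conv_lhs => rw [this]
      simp only [map_add, map_smul, smul_eq_mul]
      ring
    set p : Vec := (f (1, 0, 0, 0), f (0, 1, 0, 0), f (0, 0, 1, 0), f (0, 0, 0, 1)) with hp
    have hR0 : R p = 0 := by
      rw [← inner_self_eq_zero (𝕜 := ℝ), hR, ← hfp]
      exact hf ⟨_, rfl⟩
    refine ⟨p, fun h => hf0 ?_, ?_⟩
    · simp only [hp, Prod.ext_iff, Prod.fst_zero, Prod.snd_zero] at h
      refine LinearMap.ext fun w => ?_
      rw [hfp, h.1, h.2.1, h.2.2.1, h.2.2.2]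
      simp
    · have hz : ∀ᵐ s ∂(volume.restrict (Icc a b)), R p s = 0 := by
        rw [hR0]; exact Lp.coeFn_zero _ _ _
      -- The relation `R p = 0` holds almost everywhere; continuity and `a < b` give it at every
      -- point.
      have e0 : EqOn (fun s => p.1 + p.2.2.1 * G₁ s + p.2.2.2 * H₁ s) (fun _ => 0) (Icc a b) := by
        refine Measure.eqOn_Icc_of_ae_eq volume hab.ne ?_ (by fun_prop) continuousOn_const
        filter_upwards [hRae p, hz] with s hs hz
        rw [← hs.1, hz]; rfl
      have e1 : EqOn (fun s => p.2.1 + p.2.2.1 * G₂ s + p.2.2.2 * H₂ s) (fun _ => 0)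
          (Icc a b) := by
        refine Measure.eqOn_Icc_of_ae_eq volume hab.ne ?_ (by fun_prop) continuousOn_const
        filter_upwards [hRae p, hz] with s hs hz
        rw [← hs.2, hz]; rfl
      exact fun s hs => ⟨e0 hs, e1 hs⟩
  · rintro ⟨p, hp0, hp⟩ hs
    have hR0 : R p = 0 := by
      refine Lp.ext ?_
      filter_upwards [hRae p, Lp.coeFn_zero (EuclideanSpace ℝ (Fin 2)) 2
        (volume.restrict (Icc a b)), ae_restrict_mem measurableSet_Icc] with s e1 e2 hm
      rw [e2]
      ext i
      fin_cases i
      · exact e1.1.trans (hp s hm).1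
      · exact e1.2.trans (hp s hm).2
    -- Pairing `R p = 0` with a preimage of `p` itself makes the sum of the squares of its
    -- components vanish.
    obtain ⟨v, hv⟩ := hs p
    have := hR p v
    rw [hR0, inner_zero_left, hv] at this
    apply hp0
    obtain ⟨p1, p2, p3, p4⟩ := p
    simp only at this
    have k1 : p1 = 0 := by nlinarith [sq_nonneg p1, sq_nonneg p2, sq_nonneg p3, sq_nonneg p4]
    have k2 : p2 = 0 := by nlinarith [sq_nonneg p1, sq_nonneg p2, sq_nonneg p3, sq_nonneg p4]
    have k3 : p3 = 0 := by nlinarith [sq_nonneg p1, sq_nonneg p2, sq_nonneg p3, sq_nonneg p4]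
    have k4 : p4 = 0 := by nlinarith [sq_nonneg p1, sq_nonneg p2, sq_nonneg p3, sq_nonneg p4]
    simp [k1, k2, k3, k4]

end Covector

section Adjoint

variable (hab : a ≤ b) (ℓ θ₀ : ℝ) (u : Control a b)

/-- The integrating factor, normalized to be `1` at the end. -/
def adjointFactor (s : ℝ) : ℝ :=
  Real.exp (liftGrowth hab ℓ θ₀ u s - liftGrowth hab ℓ θ₀ u b)

theorem adjointFactor_pos (s : ℝ) : 0 < adjointFactor hab ℓ θ₀ u s := Real.exp_pos _

theorem isPrimitiveOn_adjointFactor :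
    IsPrimitiveOn a b (adjointFactor hab ℓ θ₀ u) fun s => adjointFactor hab ℓ θ₀ u s *
      (u s 0 / ℓ * Real.cos (liftAngle hab ℓ θ₀ u s)
        + u s 1 / ℓ * Real.sin (liftAngle hab ℓ θ₀ u s)) := by
  have h := (isPrimitiveOn_liftGrowth hab ℓ θ₀ u).sub
    (isPrimitiveOn_const (liftGrowth hab ℓ θ₀ u b))
  simp only [sub_zero] at h
  exact h.comp hab Real.hasDerivAt_exp Real.continuous_exp

/-- In the product rule the mixed terms `sin θ cos θ` cancel and `sin² + cos² = 1` removes the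
angle. Only the factor times a control component survives, which is why the covector relations can
be differentiated usefully. -/
theorem isPrimitiveOn_adjointFactor_mul_sin :
    IsPrimitiveOn a b
      (fun s => adjointFactor hab ℓ θ₀ u s * Real.sin (liftAngle hab ℓ θ₀ u s))
      fun s => adjointFactor hab ℓ θ₀ u s * (u s 1 / ℓ) := by
  refine ((isPrimitiveOn_adjointFactor hab ℓ θ₀ u).mul
    ((isSteered_liftAngle hab ℓ θ₀ u).comp hab Real.hasDerivAt_sin Real.continuous_cos)
    hab).congr_right' hab fun s _ => ?_
  simp only [steer]
  linear_combination adjointFactor hab ℓ θ₀ u s * (u s 1 / ℓ) *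
    Real.sin_sq_add_cos_sq (liftAngle hab ℓ θ₀ u s)

theorem isPrimitiveOn_adjointFactor_mul_cos :
    IsPrimitiveOn a b
      (fun s => adjointFactor hab ℓ θ₀ u s * Real.cos (liftAngle hab ℓ θ₀ u s))
      fun s => adjointFactor hab ℓ θ₀ u s * (u s 0 / ℓ) := by
  refine ((isPrimitiveOn_adjointFactor hab ℓ θ₀ u).mul
    ((isSteered_liftAngle hab ℓ θ₀ u).comp hab Real.hasDerivAt_cos
      (Real.continuous_sin.neg)) hab).congr_right' hab fun s _ => ?_
  simp only [steer]
  linear_combination adjointFactor hab ℓ θ₀ u s * (u s 0 / ℓ) *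
    Real.sin_sq_add_cos_sq (liftAngle hab ℓ θ₀ u s)

end Adjoint

section Criterion

variable {ℓ₁ ℓ₂ θ₁ θ₂ : ℝ} {u : Control a b}

/-- If the path of `u` is singular then its velocity is proportional to `ξ`. -/
theorem orthogonal_of_not_surjective (hab : a < b) (h₁ : 0 < ℓ₁) (h₂ : 0 < ℓ₂)
    (hs : ¬ Function.Surjective (displacementDeriv hab.le ℓ₁ ℓ₂ θ₁ θ₂ u)) :
    ∀ᵐ s ∂(volume.restrict (Icc a b)),
      u s 0 * (Real.cos (liftAngle hab.le ℓ₁ θ₁ u s) / ℓ₁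
        - Real.cos (liftAngle hab.le ℓ₂ θ₂ u s) / ℓ₂)
      + u s 1 * (Real.sin (liftAngle hab.le ℓ₁ θ₁ u s) / ℓ₁
        - Real.sin (liftAngle hab.le ℓ₂ θ₂ u s) / ℓ₂) = 0 := by
  obtain ⟨⟨p₁, p₂, p₃, p₄⟩, hp0, hp⟩ := (not_surjective_iff hab).1 hs
  have P₁ := isPrimitiveOn_adjointFactor hab.le ℓ₁ θ₁ u
  have P₂ := isPrimitiveOn_adjointFactor hab.le ℓ₂ θ₂ u
  have S₁ := isPrimitiveOn_adjointFactor_mul_sin hab.le ℓ₁ θ₁ u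
  have S₂ := isPrimitiveOn_adjointFactor_mul_sin hab.le ℓ₂ θ₂ u
  have C₁ := isPrimitiveOn_adjointFactor_mul_cos hab.le ℓ₁ θ₁ u
  have C₂ := isPrimitiveOn_adjointFactor_mul_cos hab.le ℓ₂ θ₂ u
  have pos₁ := adjointFactor_pos hab.le ℓ₁ θ₁ u
  have pos₂ := adjointFactor_pos hab.le ℓ₂ θ₂ u
  have hp' : ∀ s ∈ Icc a b,
      p₃ / ℓ₁ * (adjointFactor hab.le ℓ₁ θ₁ u s * Real.sin (liftAngle hab.le ℓ₁ θ₁ u s))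
        + p₄ / ℓ₂ * (adjointFactor hab.le ℓ₂ θ₂ u s * Real.sin (liftAngle hab.le ℓ₂ θ₂ u s)) = p₁
      ∧ p₃ / ℓ₁ * (adjointFactor hab.le ℓ₁ θ₁ u s * Real.cos (liftAngle hab.le ℓ₁ θ₁ u s))
        + p₄ / ℓ₂ * (adjointFactor hab.le ℓ₂ θ₂ u s * Real.cos (liftAngle hab.le ℓ₂ θ₂ u s))
          = -p₂ := fun s hs => by
    obtain ⟨e1, e2⟩ := hp s hs
    simp only [angleGrad₁, angleGrad₂] at e1 e2
    simp only [adjointFactor]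
    exact ⟨by linear_combination -e1, by linear_combination e2⟩
  set Q₁ := adjointFactor hab.le ℓ₁ θ₁ u
  set Q₂ := adjointFactor hab.le ℓ₂ θ₂ u
  set α₁ := liftAngle hab.le ℓ₁ θ₁ u
  set α₂ := liftAngle hab.le ℓ₂ θ₂ u
  -- The left-hand sides of the covector relations are constant, so their derivatives vanish almost
  -- everywhere.
  have hsin := (((S₁.const_mul (p₃ / ℓ₁)).add (S₂.const_mul (p₄ / ℓ₂))).congr_left hab.le
    (G := fun _ => p₁) fun s hs => (hp' s hs).1).ae_eq (isPrimitiveOn_const p₁) hab.le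
  have hcos := (((C₁.const_mul (p₃ / ℓ₁)).add (C₂.const_mul (p₄ / ℓ₂))).congr_left hab.le
    (G := fun _ => -p₂) fun s hs => (hp' s hs).2).ae_eq (isPrimitiveOn_const (-p₂)) hab.le
  have hH := (P₁.const_mul (p₃ / ℓ₁ ^ 2)).add (P₂.const_mul (p₄ / ℓ₂ ^ 2))
  have hzero : ∀ᵐ s ∂(volume.restrict (Icc a b)),
      u s 0 * (p₃ / ℓ₁ ^ 2 * Q₁ s + p₄ / ℓ₂ ^ 2 * Q₂ s) = 0 ∧
      u s 1 * (p₃ / ℓ₁ ^ 2 * Q₁ s + p₄ / ℓ₂ ^ 2 * Q₂ s) = 0 := by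
    filter_upwards [hsin, hcos] with s e1 e2
    refine ⟨?_, ?_⟩
    · rw [← e2]; field
    · rw [← e1]; field
  -- Write `h` for `p₃ Q₁ / ℓ₁² + p₄ Q₂ / ℓ₂²`. Its derivative is linear in `u`, so `h u = 0` forces
  -- `2 h h' = 0` and `h ^ 2` is constant.
  have hsq := (hH.mul hH hab.le).congr_right hab.le (g := fun _ => 0) (by
    filter_upwards [hzero] with s hs
    have e : p₃ / ℓ₁ ^ 2 * (Q₁ s * (u s 0 / ℓ₁ * Real.cos (α₁ s) + u s 1 / ℓ₁ * Real.sin (α₁ s)))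
        + p₄ / ℓ₂ ^ 2 * (Q₂ s * (u s 0 / ℓ₂ * Real.cos (α₂ s) + u s 1 / ℓ₂ * Real.sin (α₂ s)))
        = u s 0 * (p₃ / ℓ₁ ^ 2 * Q₁ s * Real.cos (α₁ s) / ℓ₁
            + p₄ / ℓ₂ ^ 2 * Q₂ s * Real.cos (α₂ s) / ℓ₂)
          + u s 1 * (p₃ / ℓ₁ ^ 2 * Q₁ s * Real.sin (α₁ s) / ℓ₁
            + p₄ / ℓ₂ ^ 2 * Q₂ s * Real.sin (α₂ s) / ℓ₂) := by ring
    rw [e]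
    linear_combination 2 * (p₃ / ℓ₁ ^ 2 * Q₁ s * Real.cos (α₁ s) / ℓ₁
            + p₄ / ℓ₂ ^ 2 * Q₂ s * Real.cos (α₂ s) / ℓ₂) * hs.1
      + 2 * (p₃ / ℓ₁ ^ 2 * Q₁ s * Real.sin (α₁ s) / ℓ₁
            + p₄ / ℓ₂ ^ 2 * Q₂ s * Real.sin (α₂ s) / ℓ₂) * hs.2)
  have hconst : ∀ s ∈ Icc a b, (p₃ / ℓ₁ ^ 2 * Q₁ s + p₄ / ℓ₂ ^ 2 * Q₂ s)
      * (p₃ / ℓ₁ ^ 2 * Q₁ s + p₄ / ℓ₂ ^ 2 * Q₂ s)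
      = (p₃ / ℓ₁ ^ 2 * Q₁ a + p₄ / ℓ₂ ^ 2 * Q₂ a)
        * (p₃ / ℓ₁ ^ 2 * Q₁ a + p₄ / ℓ₂ ^ 2 * Q₂ a) := fun s hs => by
    simpa using hsq.2 s hs
  by_cases hz : p₃ / ℓ₁ ^ 2 * Q₁ a + p₄ / ℓ₂ ^ 2 * Q₂ a = 0
  · have hvan : ∀ s ∈ Icc a b, p₃ / ℓ₁ ^ 2 * Q₁ s + p₄ / ℓ₂ ^ 2 * Q₂ s = 0 := fun s hs => by
      have := hconst s hs
      rw [hz, mul_zero] at this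
      exact mul_self_eq_zero.1 this
    -- If `p₃ = 0`, then `h = 0` and `Q₂ > 0` give `p₄ = 0`, and the covector relations make `p`
    -- vanish.
    have hp₃ : p₃ ≠ 0 := by
      rintro rfl
      have ha : a ∈ Icc a b := left_mem_Icc.2 hab.le
      have k4 : p₄ = 0 := by
        have := hvan a ha
        simp only [zero_div, zero_mul, zero_add, mul_eq_zero, div_eq_zero_iff, (pos₂ a).ne',
          or_false, pow_eq_zero_iff two_ne_zero, h₂.ne'] at this
        exact this
      have := hp' a ha
      simp only [k4, zero_div, zero_mul, add_zero] at this
      apply hp0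
      rw [k4, ← this.1, neg_eq_zero.1 this.2.symm]
      rfl
    -- Eliminating `p₄` from `h = 0` and `h' = 0` leaves `(p₃ Q₁ / ℓ₁²) (A₁' - A₂') = 0`.
    have hd := (hH.congr_left hab.le (G := fun _ => 0) hvan).ae_eq (isPrimitiveOn_const 0) hab.le
    filter_upwards [hd, ae_restrict_mem measurableSet_Icc] with s e1 hm
    have e2 := hvan s hm
    have e3 : p₃ / ℓ₁ ^ 2 * Q₁ s ≠ 0 :=
      mul_ne_zero (div_ne_zero hp₃ (pow_ne_zero 2 h₁.ne')) (pos₁ s).ne'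
    refine (mul_eq_zero.1 ?_).resolve_left e3
    linear_combination e1 - (u s 0 / ℓ₂ * Real.cos (α₂ s) + u s 1 / ℓ₂ * Real.sin (α₂ s)) * e2
  · filter_upwards [hzero, ae_restrict_mem measurableSet_Icc] with s e1 hm
    have hne : p₃ / ℓ₁ ^ 2 * Q₁ s + p₄ / ℓ₂ ^ 2 * Q₂ s ≠ 0 := fun h0 => by
      have := hconst s hm
      rw [h0, mul_zero] at this
      exact hz (mul_self_eq_zero.1 this.symm)
    rw [(mul_eq_zero.1 e1.1).resolve_right hne, (mul_eq_zero.1 e1.2).resolve_right hne]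
    simp

/-- If the velocity of the path of `u` is proportional to `ξ` then the path is singular. -/
theorem not_surjective_of_orthogonal (hab : a < b) (h₁ : 0 < ℓ₁) (h₂ : 0 < ℓ₂)
    (ho : ∀ᵐ s ∂(volume.restrict (Icc a b)),
      u s 0 * (Real.cos (liftAngle hab.le ℓ₁ θ₁ u s) / ℓ₁
        - Real.cos (liftAngle hab.le ℓ₂ θ₂ u s) / ℓ₂)
      + u s 1 * (Real.sin (liftAngle hab.le ℓ₁ θ₁ u s) / ℓ₁
        - Real.sin (liftAngle hab.le ℓ₂ θ₂ u s) / ℓ₂) = 0) :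
    ¬ Function.Surjective (displacementDeriv hab.le ℓ₁ ℓ₂ θ₁ θ₂ u) := by
  rw [not_surjective_iff hab]
  have S₁ := isPrimitiveOn_adjointFactor_mul_sin hab.le ℓ₁ θ₁ u
  have S₂ := isPrimitiveOn_adjointFactor_mul_sin hab.le ℓ₂ θ₂ u
  have C₁ := isPrimitiveOn_adjointFactor_mul_cos hab.le ℓ₁ θ₁ u
  have C₂ := isPrimitiveOn_adjointFactor_mul_cos hab.le ℓ₂ θ₂ u
  -- The orthogonality hypothesis is the equality of the derivatives of the two growth exponents,
  -- which both start at `0`.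
  have hAA : ∀ s ∈ Icc a b, liftGrowth hab.le ℓ₁ θ₁ u s = liftGrowth hab.le ℓ₂ θ₂ u s := by
    intro s hs
    have h := ((isPrimitiveOn_liftGrowth hab.le ℓ₁ θ₁ u).sub
      (isPrimitiveOn_liftGrowth hab.le ℓ₂ θ₂ u)).eq_of_ae_zero hab.le (by
        filter_upwards [ho] with s hs
        linear_combination hs) hs
    simp only [liftGrowth, growth, intervalIntegral.integral_same, sub_self] at h
    exact sub_eq_zero.1 h
  have hQ : ∀ s ∈ Icc a b, adjointFactor hab.le ℓ₁ θ₁ u s = adjointFactor hab.le ℓ₂ θ₂ u s :=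
    fun s hs => by
      simp only [adjointFactor]
      rw [hAA s hs, hAA b (right_mem_Icc.2 hab.le)]
  have hsin := (S₁.const_mul ℓ₁).sub (S₂.const_mul ℓ₂)
  have hcos := (C₁.const_mul ℓ₁).sub (C₂.const_mul ℓ₂)
  have esin := fun s (hs : s ∈ Icc a b) => (hsin.congr_right' hab.le (g := fun _ => 0)
    fun s hs => by beta_reduce; rw [hQ s hs]; field).eq_of_ae_zero hab.le
      (Eventually.of_forall fun _ => rfl) hs
  have ecos := fun s (hs : s ∈ Icc a b) => (hcos.congr_right' hab.le (g := fun _ => 0)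
    fun s hs => by beta_reduce; rw [hQ s hs]; field).eq_of_ae_zero hab.le
      (Eventually.of_forall fun _ => rfl) hs
  -- The choice `p₃ = ℓ₁ ^ 2`, `p₄ = -ℓ₂ ^ 2` makes `h` vanish when `Q₁ = Q₂`; the other two entries
  -- are the conserved quantities, evaluated at `a`.
  refine ⟨(ℓ₁ * (adjointFactor hab.le ℓ₁ θ₁ u a * Real.sin (liftAngle hab.le ℓ₁ θ₁ u a))
      - ℓ₂ * (adjointFactor hab.le ℓ₂ θ₂ u a * Real.sin (liftAngle hab.le ℓ₂ θ₂ u a)),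
    -(ℓ₁ * (adjointFactor hab.le ℓ₁ θ₁ u a * Real.cos (liftAngle hab.le ℓ₁ θ₁ u a))
      - ℓ₂ * (adjointFactor hab.le ℓ₂ θ₂ u a * Real.cos (liftAngle hab.le ℓ₂ θ₂ u a))),
    ℓ₁ ^ 2, -ℓ₂ ^ 2), ?_, fun s hs => ?_⟩
  · intro h
    have := congrArg (fun p : Vec => p.2.2.1) h
    exact pow_ne_zero 2 h₁.ne' this
  · have e1 := esin s hs
    have e2 := ecos s hs
    beta_reduce at e1 e2
    rw [← e1, ← e2]
    simp only [adjointFactor, angleGrad₁, angleGrad₂]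
    exact ⟨by field, by field⟩

end Criterion

/-- A curve is singular if and only if its velocity is proportional to `ξ` almost everywhere. -/
theorem isSingular_iff {ℓ₁ ℓ₂ : ℝ} (hab : a < b) (h₁ : 0 < ℓ₁) (h₂ : 0 < ℓ₂) (γ : ℝ → Pos) :
    IsSingular ℓ₁ ℓ₂ a b γ ↔ ∃ u, IsControlledBy ℓ₁ ℓ₂ a b γ u ∧
      ∀ᵐ s ∂(volume.restrict (Icc a b)),
        u s 0 * ((γ s).2.2.1.cos / ℓ₁ - (γ s).2.2.2.cos / ℓ₂)
          + u s 1 * ((γ s).2.2.1.sin / ℓ₁ - (γ s).2.2.2.sin / ℓ₂) = 0 := by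
  obtain ⟨z, hz⟩ := cover_surjective (γ a)
  rw [isSingular_iff_not_surjective hab.le h₁ h₂ hz.symm]
  refine exists_congr fun u => and_congr_right fun hu => ?_
  have hγ := (isControlledBy_iff hab.le u hz.symm).1 hu
  have hiff : ∀ᵐ s ∂(volume.restrict (Icc a b)), (u s 0 * ((γ s).2.2.1.cos / ℓ₁
      - (γ s).2.2.2.cos / ℓ₂) + u s 1 * ((γ s).2.2.1.sin / ℓ₁ - (γ s).2.2.2.sin / ℓ₂) = 0 ↔
      u s 0 * (Real.cos (liftAngle hab.le ℓ₁ z.2.2.1 u s) / ℓ₁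
        - Real.cos (liftAngle hab.le ℓ₂ z.2.2.2 u s) / ℓ₂)
      + u s 1 * (Real.sin (liftAngle hab.le ℓ₁ z.2.2.1 u s) / ℓ₁
        - Real.sin (liftAngle hab.le ℓ₂ z.2.2.2 u s) / ℓ₂) = 0) := by
    filter_upwards [ae_restrict_mem measurableSet_Icc] with s hs
    rw [hγ s hs]
    simp [cover, liftPath]
  rw [eventually_congr hiff]
  exact ⟨orthogonal_of_not_surjective hab h₁ h₂, not_surjective_of_orthogonal hab h₁ h₂⟩

/-! ### Global integral curves of `ξ` -/

open scoped Manifold in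
/-- A bounded Lipschitz `C¹` vector field on the line has a global integral curve. -/
theorem exists_global_integralCurve {h : ℝ → ℝ} (hc : ContDiff ℝ 1 h) {M K : NNReal}
    (hM : ∀ x, ‖h x‖ ≤ M) (hK : LipschitzWith K h) (x₀ : ℝ) :
    ∃ β : ℝ → ℝ, β 0 = x₀ ∧ ∀ t, HasDerivAt β (h (β t)) t := by
  have hloc : ∀ x : ℝ, ∃ γ : ℝ → ℝ, γ 0 = x ∧
      IsMIntegralCurveOn (I := 𝓘(ℝ, ℝ)) γ h (Ioo (-1) 1) := fun x => by
    -- At speed at most `M` a solution stays within distance `M` for unit time. The existence time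
    -- does not depend on the starting point, so solutions extend to the whole line.
    have hpl : IsPicardLindelof (fun _ => h) (tmin := -1) (tmax := 1)
        ⟨0, by norm_num, by norm_num⟩ x M 0 M K :=
      ⟨fun t _ => hK.lipschitzOnWith, fun x _ => continuousOn_const, fun t _ x _ => hM x, by simp⟩
    obtain ⟨γ, h0, hγ⟩ := hpl.exists_eq_forall_mem_Icc_hasDerivWithinAt₀
    refine ⟨γ, h0, fun t ht => ?_⟩
    have := (hγ t (Ioo_subset_Icc_self ht)).hasDerivAt (Icc_mem_nhds ht.1 ht.2)
    exact this.hasFDerivAt.hasMFDerivAt.hasMFDerivWithinAt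
  obtain ⟨β, h0, hβ⟩ := exists_isMIntegralCurve_of_isMIntegralCurveOn (I := 𝓘(ℝ, ℝ)) (v := h)
    (contMDiff_vectorSpace_iff_contDiff.2 hc) one_pos hloc x₀
  refine ⟨β, h0, fun t => ?_⟩
  have ht : HasFDerivAt β ((1 : ℝ →L[ℝ] ℝ).smulRight (h (β t))) t :=
    hasMFDerivAt_iff_hasFDerivAt.1 (hβ t)
  simpa using ht.hasDerivAt

/-- The angular velocity of the first link along `ξ`, as a function of the difference of angles. -/
def angularVelocity₁ (ℓ₁ ℓ₂ β : ℝ) : ℝ := -((1 / ℓ₁ - Real.cos β / ℓ₂) / ℓ₁)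

/-- The angular velocity of the second link along `ξ`, as a function of the difference of angles. -/
def angularVelocity₂ (ℓ₁ ℓ₂ β : ℝ) : ℝ := -((Real.cos β / ℓ₁ - 1 / ℓ₂) / ℓ₂)

/-- By `sin² + cos² = 1` and the formula for the cosine of a difference, the angular components
depend only on `θ₁ - θ₂`. This decouples the flow of `ξ`: a scalar equation for the difference, then
quadratures. -/
theorem ξ_cover (ℓ₁ ℓ₂ : ℝ) (z : Vec) : ξ ℓ₁ ℓ₂ (cover z) =
    (Real.sin z.2.2.1 / ℓ₁ - Real.sin z.2.2.2 / ℓ₂,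
      -(Real.cos z.2.2.1 / ℓ₁ - Real.cos z.2.2.2 / ℓ₂),
      angularVelocity₁ ℓ₁ ℓ₂ (z.2.2.1 - z.2.2.2), angularVelocity₂ ℓ₁ ℓ₂ (z.2.2.1 - z.2.2.2)) := by
  obtain ⟨x, y, θ₁, θ₂⟩ := z
  have e1 := Real.sin_sq_add_cos_sq θ₁
  have e2 := Real.sin_sq_add_cos_sq θ₂
  simp only [ξ, v₁, v₂, cover, angularVelocity₁, angularVelocity₂, Real.Angle.sin_coe,
    Real.Angle.cos_coe, Prod.smul_mk, Prod.mk_sub_mk, smul_eq_mul, Prod.mk.injEq, Real.cos_sub]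
  refine ⟨by ring, by ring, ?_, ?_⟩
  · linear_combination (-1 / ℓ₁ / ℓ₁) * e1
  · linear_combination (1 / ℓ₂ / ℓ₂) * e2

/-- The velocity of the difference of angles along `ξ`. -/
def differenceVelocity (ℓ₁ ℓ₂ β : ℝ) : ℝ :=
  angularVelocity₁ ℓ₁ ℓ₂ β - angularVelocity₂ ℓ₁ ℓ₂ β

theorem differenceVelocity_eq (ℓ₁ ℓ₂ β : ℝ) : differenceVelocity ℓ₁ ℓ₂ β =
    -(1 / ℓ₁ ^ 2 + 1 / ℓ₂ ^ 2) + 2 / (ℓ₁ * ℓ₂) * Real.cos β := by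
  simp only [differenceVelocity, angularVelocity₁, angularVelocity₂]
  ring

theorem abs_differenceVelocity_sub_le (ℓ₁ ℓ₂ x y : ℝ) :
    |differenceVelocity ℓ₁ ℓ₂ x - differenceVelocity ℓ₁ ℓ₂ y| ≤ |2 / (ℓ₁ * ℓ₂)| * |x - y| := by
  rw [differenceVelocity_eq, differenceVelocity_eq, add_sub_add_left_eq_sub, ← mul_sub, abs_mul]
  exact mul_le_mul_of_nonneg_left (Real.abs_cos_sub_cos_le x y) (abs_nonneg _)

theorem lipschitzWith_differenceVelocity (ℓ₁ ℓ₂ : ℝ) :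
    LipschitzWith ‖2 / (ℓ₁ * ℓ₂)‖₊ (differenceVelocity ℓ₁ ℓ₂) :=
  LipschitzWith.of_dist_le_mul fun x y => by
    rw [Real.dist_eq, Real.dist_eq, coe_nnnorm, Real.norm_eq_abs]
    exact abs_differenceVelocity_sub_le ℓ₁ ℓ₂ x y

theorem exists_difference_curve (ℓ₁ ℓ₂ β₀ : ℝ) :
    ∃ β : ℝ → ℝ, β 0 = β₀ ∧ ∀ t, HasDerivAt β (differenceVelocity ℓ₁ ℓ₂ (β t)) t := by
  refine exists_global_integralCurve (M := ‖1 / ℓ₁ ^ 2 + 1 / ℓ₂ ^ 2‖₊ + ‖2 / (ℓ₁ * ℓ₂)‖₊) ?_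
    (fun x => ?_) (lipschitzWith_differenceVelocity ℓ₁ ℓ₂) β₀
  · have : differenceVelocity ℓ₁ ℓ₂ =
        fun β => -(1 / ℓ₁ ^ 2 + 1 / ℓ₂ ^ 2) + 2 / (ℓ₁ * ℓ₂) * Real.cos β :=
      funext (differenceVelocity_eq ℓ₁ ℓ₂)
    rw [this]
    fun_prop
  · rw [differenceVelocity_eq]
    refine (norm_add_le _ _).trans ?_
    rw [norm_neg, norm_mul, NNReal.coe_add, coe_nnnorm, coe_nnnorm]
    gcongr
    exact mul_le_of_le_one_right (norm_nonneg _) (Real.abs_cos_le_one x)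

theorem hasDerivAt_vec {C : ℝ → Vec} {w : Vec} {t : ℝ} (h1 : HasDerivAt (fun s => (C s).1) w.1 t)
    (h2 : HasDerivAt (fun s => (C s).2.1) w.2.1 t)
    (h3 : HasDerivAt (fun s => (C s).2.2.1) w.2.2.1 t)
    (h4 : HasDerivAt (fun s => (C s).2.2.2) w.2.2.2 t) : HasDerivAt C w t :=
  h1.prodMk (h2.prodMk (h3.prodMk h4))

theorem hasVelocityAt_cover {C : ℝ → Vec} {w : Vec} {t : ℝ} (h : HasDerivAt C w t) :
    HasVelocityAt (fun s => cover (C s)) w t := by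
  refine ⟨fun s => C s - C t, sub_self _, (h.sub_const (C t)).hasFDerivAt,
    Eventually.of_forall fun s => ?_⟩
  beta_reduce
  rw [cover_sub]; abel

/-- Every point of the configuration space lies on a global integral curve of `ξ`. -/
theorem exists_integralCurve (ℓ₁ ℓ₂ : ℝ) (z : Vec) (hz : cover z ∈ configSpace ℓ₁ ℓ₂) :
    ∃ C : ℝ → Vec, C 0 = z ∧ (∀ t, HasDerivAt C (ξ ℓ₁ ℓ₂ (cover (C t))) t) ∧
      IsIntegralCurve ℓ₁ ℓ₂ (fun t => cover (C t)) univ := by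
  obtain ⟨x, y, θ₁, θ₂⟩ := z
  obtain ⟨β, hβ0, hβ⟩ := exists_difference_curve ℓ₁ ℓ₂ (θ₁ - θ₂)
  have hβc : Continuous β := continuous_iff_continuousAt.2 fun t => (hβ t).continuousAt
  have prim : ∀ (f : ℝ → ℝ) (c : ℝ), Continuous f →
      ∀ t, HasDerivAt (fun t => c + ∫ s in (0 : ℝ)..t, f s) (f t) t := fun f c hf t =>
    (hf.integral_hasStrictDerivAt 0 t).hasDerivAt.const_add c
  let α₁ : ℝ → ℝ := fun t => θ₁ + ∫ s in (0 : ℝ)..t, angularVelocity₁ ℓ₁ ℓ₂ (β s)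
  have hα₁ : ∀ t, HasDerivAt α₁ (angularVelocity₁ ℓ₁ ℓ₂ (β t)) t :=
    prim _ _ (by unfold angularVelocity₁; fun_prop)
  let α₂ : ℝ → ℝ := fun t => α₁ t - β t
  have hα₂ : ∀ t, HasDerivAt α₂ (angularVelocity₂ ℓ₁ ℓ₂ (β t)) t := fun t =>
    ((hα₁ t).sub (hβ t)).congr_deriv (by simp only [differenceVelocity]; ring)
  have hα₁c : Continuous α₁ := continuous_iff_continuousAt.2 fun t => (hα₁ t).continuousAt
  have hα₂c : Continuous α₂ := hα₁c.sub hβc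
  let C : ℝ → Vec := fun t => (x + ∫ s in (0 : ℝ)..t, (Real.sin (α₁ s) / ℓ₁ - Real.sin (α₂ s) / ℓ₂),
    y + ∫ s in (0 : ℝ)..t, -(Real.cos (α₁ s) / ℓ₁ - Real.cos (α₂ s) / ℓ₂), α₁ t, α₂ t)
  have hdiff : ∀ t, α₁ t - α₂ t = β t := fun t => by simp [α₂]
  have hC : ∀ t, HasDerivAt C (ξ ℓ₁ ℓ₂ (cover (C t))) t := fun t => by
    rw [ξ_cover]
    refine hasDerivAt_vec (prim _ _ (by fun_prop) t) (prim _ _ (by fun_prop) t) ?_ ?_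
    · simpa only [C, hdiff] using hα₁ t
    · simpa only [C, hdiff] using hα₂ t
  have hC0 : C 0 = (x, y, θ₁, θ₂) := by simp [C, α₁, α₂, hβ0]
  refine ⟨C, hC0, hC, fun t _ => ⟨?_, hasVelocityAt_cover (hC t)⟩⟩
  -- For equal lengths the multiples of `2π` are equilibria of the difference equation, so a curve
  -- that reaches `α₁ = α₂` would have started there.
  intro hℓ heq
  obtain ⟨k, hk⟩ := Real.Angle.angle_eq_iff_two_pi_dvd_sub.1 heq
  have hk' : β t = 2 * Real.pi * k := (hdiff t).symm.trans hk
  have hv : differenceVelocity ℓ₁ ℓ₂ (2 * Real.pi * k) = 0 := by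
    rw [differenceVelocity_eq, show 2 * Real.pi * k = k * (2 * Real.pi) by ring,
      Real.cos_int_mul_two_pi, hℓ]
    ring
  have huniq : β = fun _ => 2 * Real.pi * k :=
    ODE_solution_unique_univ (v := fun _ => differenceVelocity ℓ₁ ℓ₂) (s := fun _ => univ) (t₀ := t)
      (fun _ => (lipschitzWith_differenceVelocity ℓ₁ ℓ₂).lipschitzOnWith)
      (fun s => ⟨hβ s, mem_univ _⟩)
      (fun s => ⟨by simpa only [hv] using hasDerivAt_const s (2 * Real.pi * (k : ℝ)), mem_univ _⟩)
      hk'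
  refine hz hℓ (Real.Angle.angle_eq_iff_two_pi_dvd_sub.2 ⟨k, ?_⟩)
  rw [← hβ0, huniq]

theorem hasDerivAt_components {C : ℝ → Vec} {w : Vec} {t : ℝ} (h : HasDerivAt C w t) :
    HasDerivAt (fun s => (C s).1) w.1 t ∧ HasDerivAt (fun s => (C s).2.1) w.2.1 t ∧
    HasDerivAt (fun s => (C s).2.2.1) w.2.2.1 t ∧ HasDerivAt (fun s => (C s).2.2.2) w.2.2.2 t := by
  have key : ∀ L : Vec →L[ℝ] ℝ, HasDerivAt (fun s => L (C s)) (L w) t := fun L =>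
    L.hasFDerivAt.comp_hasDerivAt t h
  exact ⟨key (.fst ℝ _ _), key ((ContinuousLinearMap.fst ℝ _ _).comp (.snd ℝ _ _)),
    key ((ContinuousLinearMap.fst ℝ _ _).comp ((ContinuousLinearMap.snd ℝ _ _).comp (.snd ℝ _ _))),
    key ((ContinuousLinearMap.snd ℝ _ _).comp ((ContinuousLinearMap.snd ℝ _ _).comp (.snd ℝ _ _)))⟩

/-- A curve whose velocity is `f • ξ` runs along an integral curve of `ξ`. -/
theorem exists_integralCurve_eq (hab : a ≤ b) {ℓ₁ ℓ₂ : ℝ} {γ : ℝ → Pos} {u : Control a b}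
    (hγ0 : γ a ∈ configSpace ℓ₁ ℓ₂) (hu : IsControlledBy ℓ₁ ℓ₂ a b γ u) {f : ℝ → ℝ}
    (hf : IntegrableOn f (Icc a b))
    (hfu : ∀ᵐ s ∂(volume.restrict (Icc a b)),
      u s 0 = f s * ((γ s).2.2.1.sin / ℓ₁ - (γ s).2.2.2.sin / ℓ₂) ∧
      u s 1 = -(f s * ((γ s).2.2.1.cos / ℓ₁ - (γ s).2.2.2.cos / ℓ₂))) :
    ∃ c : ℝ → Pos, IsIntegralCurve ℓ₁ ℓ₂ c univ ∧
      ∀ t ∈ Icc a b, γ t = c (∫ s in a..t, f s) := by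
  obtain ⟨z, hz⟩ := cover_surjective (γ a)
  obtain ⟨C, hC0, hC, hCint⟩ := exists_integralCurve ℓ₁ ℓ₂ z (hz ▸ hγ0)
  have hγ := (isControlledBy_iff hab u hz.symm).1 hu
  refine ⟨_, hCint, fun t ht => ?_⟩
  rw [hγ t ht]
  congr 1
  set φ : ℝ → ℝ := fun t => ∫ s in a..t, f s with hφdef
  have hφ : IsPrimitiveOn a b φ f := by
    have := isPrimitiveOn_integral hf 0
    simpa only [zero_add] using this
  have hφa : φ a = 0 := by simp [hφdef]
  have hCc : Continuous C := continuous_iff_continuousAt.2 fun t => (hC t).continuousAt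
  have hcomp := fun s => hasDerivAt_components (hC s)
  simp only [ξ_cover] at hcomp
  have D1 := hφ.comp hab (fun s => (hcomp s).1) (by fun_prop)
  have D2 := hφ.comp hab (fun s => (hcomp s).2.1) (by fun_prop)
  have D3 := hφ.comp hab (fun s => (hcomp s).2.2.1) (by unfold angularVelocity₁; fun_prop)
  have D4 := hφ.comp hab (fun s => (hcomp s).2.2.2) (by unfold angularVelocity₂; fun_prop)
  set α₁ := liftAngle hab ℓ₁ z.2.2.1 u with hα₁
  set α₂ := liftAngle hab ℓ₂ z.2.2.2 u with hα₂
  have hfu' : ∀ᵐ s ∂(volume.restrict (Icc a b)),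
      u s 0 = f s * (Real.sin (α₁ s) / ℓ₁ - Real.sin (α₂ s) / ℓ₂) ∧
      u s 1 = -(f s * (Real.cos (α₁ s) / ℓ₁ - Real.cos (α₂ s) / ℓ₂)) := by
    filter_upwards [hfu, ae_restrict_mem measurableSet_Icc] with s hs hm
    rw [hγ s hm] at hs
    simpa [cover, liftPath] using hs
  have A1 : IsPrimitiveOn a b α₁ fun s => angularVelocity₁ ℓ₁ ℓ₂ (α₁ s - α₂ s) * f s := by
    refine IsPrimitiveOn.congr_right (isSteered_liftAngle hab ℓ₁ z.2.2.1 u) hab ?_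
    filter_upwards [hfu'] with s hs
    rw [hs.1, hs.2]
    simp only [steer, angularVelocity₁, Real.cos_sub, ← hα₁]
    linear_combination (-f s / ℓ₁ / ℓ₁) * Real.sin_sq_add_cos_sq (α₁ s)
  have A2 : IsPrimitiveOn a b α₂ fun s => angularVelocity₂ ℓ₁ ℓ₂ (α₁ s - α₂ s) * f s := by
    refine IsPrimitiveOn.congr_right (isSteered_liftAngle hab ℓ₂ z.2.2.2 u) hab ?_
    filter_upwards [hfu'] with s hs
    rw [hs.1, hs.2]
    simp only [steer, angularVelocity₂, Real.cos_sub, ← hα₂]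
    linear_combination (f s / ℓ₂ / ℓ₂) * Real.sin_sq_add_cos_sq (α₂ s)
  have hα₁0 : α₁ a = z.2.2.1 := liftAngle_left ..
  have hα₂0 : α₂ a = z.2.2.2 := liftAngle_left ..
  -- Both differences solve `β' = f · differenceVelocity β` with the same initial value; Grönwall
  -- with kernel a multiple of `|f|` and constant `0` identifies them. The remaining coordinates
  -- then have equal derivatives.
  have hβ : ∀ s ∈ Icc a b, α₁ s - α₂ s = (C (φ s)).2.2.1 - (C (φ s)).2.2.2 := by
    have hd := (A1.sub A2).sub (D3.sub D4)
    have hc := (hd.continuousOn hab).abs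
    have hk : IntegrableOn (fun s => |2 / (ℓ₁ * ℓ₂)| * |f s|) (Icc a b) := hf.abs.const_mul _
    intro s hs
    have := gronwall_integrable hab hk (fun s => by positivity) hc le_rfl (fun t ht => ?_) s hs
    · rw [mul_zero, zero_mul] at this
      exact sub_eq_zero.1 (abs_eq_zero.1 (this.antisymm (abs_nonneg _)))
    · have h1 := hd.2 t ht
      simp only [hφa, hC0, hα₁0, hα₂0, sub_self, zero_add] at h1
      rw [zero_add, h1]
      refine abs_integral_le_of_abs_le ht (hk.mul_continuousOn hc isCompact_Icc) fun r _ => ?_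
      have e := abs_differenceVelocity_sub_le ℓ₁ ℓ₂ (α₁ r - α₂ r)
        ((C (φ r)).2.2.1 - (C (φ r)).2.2.2)
      have e2 := mul_le_mul_of_nonneg_right e (abs_nonneg (f r))
      rw [← abs_mul] at e2
      simp only [differenceVelocity] at e2
      calc _ = _ := by congr 1; ring
        _ ≤ _ := e2
        _ = _ := by ring
  have E3 : ∀ s ∈ Icc a b, α₁ s = (C (φ s)).2.2.1 := fun s hs => by
    refine A1.eq_of_ae_eq D3 hab ?_ (by rw [hα₁0, hφa, hC0]) hs
    filter_upwards [ae_restrict_mem measurableSet_Icc] with r hr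
    rw [hβ r hr]
  have E4 : ∀ s ∈ Icc a b, α₂ s = (C (φ s)).2.2.2 := fun s hs => by
    linarith [hβ s hs, E3 s hs]
  have U1 : IsPrimitiveOn a b (fun t => z.1 + ∫ s in a..t, u s 0) fun s =>
      (Real.sin (C (φ s)).2.2.1 / ℓ₁ - Real.sin (C (φ s)).2.2.2 / ℓ₂) * f s := by
    refine (isPrimitiveOn_integral (Control.integrableOn u 0) z.1).congr_right hab ?_
    filter_upwards [hfu', ae_restrict_mem measurableSet_Icc] with s hs hm
    rw [hs.1, E3 s hm, E4 s hm, mul_comm]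
  have U2 : IsPrimitiveOn a b (fun t => z.2.1 + ∫ s in a..t, u s 1) fun s =>
      -(Real.cos (C (φ s)).2.2.1 / ℓ₁ - Real.cos (C (φ s)).2.2.2 / ℓ₂) * f s := by
    refine (isPrimitiveOn_integral (Control.integrableOn u 1) z.2.1).congr_right hab ?_
    filter_upwards [hfu', ae_restrict_mem measurableSet_Icc] with s hs hm
    rw [hs.2, E3 s hm, E4 s hm]; ring
  refine Prod.ext ?_ (Prod.ext ?_ (Prod.ext (E3 t ht) (E4 t ht)))
  · exact U1.eq_of_ae_eq D1 hab (Eventually.of_forall fun _ => rfl) (by simp [hφa, hC0]) ht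
  · exact U2.eq_of_ae_eq D2 hab (Eventually.of_forall fun _ => rfl) (by simp [hφa, hC0]) ht

/-! ### Recovering curves from their velocity -/

theorem HasVelocityAt.continuousAt {c : ℝ → Pos} {w : Vec} {t : ℝ} (h : HasVelocityAt c w t) :
    ContinuousAt c t := by
  obtain ⟨δ, -, hδ, hev⟩ := h
  have h1 : ContinuousAt (fun y => c t + cover (δ y)) t :=
    continuousAt_const.add (continuous_cover.continuousAt.comp hδ.continuousAt)
  exact h1.congr (hev.mono fun y hy => hy.symm)

/-- Angle-valued functions are handled through their cosine and sine, which are real-valued and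
together determine the angle. -/
theorem hasDerivAt_cos_angle_of_zero {d : ℝ → Real.Angle} {e : ℝ → ℝ} {t : ℝ}
    (he : HasDerivAt e 0 t) (hev : ∀ᶠ y in 𝓝 t, d y = d t + (e y : Real.Angle)) :
    HasDerivAt (fun y => (d y).cos) 0 t ∧ HasDerivAt (fun y => (d y).sin) 0 t := by
  have h1 : HasDerivAt (fun y => (d t).cos * Real.cos (e y) - (d t).sin * Real.sin (e y)) 0 t :=
    ((he.cos.const_mul (d t).cos).sub (he.sin.const_mul (d t).sin)).congr_deriv (by simp)
  have h2 : HasDerivAt (fun y => (d t).sin * Real.cos (e y) + (d t).cos * Real.sin (e y)) 0 t :=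
    ((he.cos.const_mul (d t).sin).add (he.sin.const_mul (d t).cos)).congr_deriv (by simp)
  refine ⟨h1.congr_of_eventuallyEq ?_, h2.congr_of_eventuallyEq ?_⟩
  · filter_upwards [hev] with y hy
    rw [hy, Real.Angle.cos_add, Real.Angle.cos_coe, Real.Angle.sin_coe]
  · filter_upwards [hev] with y hy
    rw [hy, Real.Angle.sin_add, Real.Angle.cos_coe, Real.Angle.sin_coe]

theorem angle_eq_of_cos_sin {α β : Real.Angle} (hc : α.cos = β.cos) (hs : α.sin = β.sin) :
    α = β := by
  induction α using Real.Angle.induction_on with | _ α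
  induction β using Real.Angle.induction_on with | _ β
  exact Real.Angle.cos_sin_inj hc hs

theorem eq_left_of_hasDerivAt_zero {g : ℝ → ℝ} (h : ∀ t ∈ Icc a b, HasDerivAt g 0 t) :
    ∀ t ∈ Icc a b, g t = g a :=
  constant_of_has_deriv_right_zero (fun t ht => (h t ht).continuousAt.continuousWithinAt)
    fun t ht => (h t (Ico_subset_Icc_self ht)).hasDerivWithinAt

theorem eq_left_of_hasVelocityAt_zero {d : ℝ → Pos} (h : ∀ t ∈ Icc a b, HasVelocityAt d 0 t) :
    ∀ t ∈ Icc a b, d t = d a := by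
  have key : ∀ t ∈ Icc a b, HasDerivAt (fun y => (d y).1) 0 t ∧
      HasDerivAt (fun y => (d y).2.1) 0 t ∧
      (HasDerivAt (fun y => (d y).2.2.1.cos) 0 t ∧ HasDerivAt (fun y => (d y).2.2.1.sin) 0 t) ∧
      (HasDerivAt (fun y => (d y).2.2.2.cos) 0 t ∧ HasDerivAt (fun y => (d y).2.2.2.sin) 0 t) := by
    intro t ht
    obtain ⟨δ, -, hδ, hev⟩ := h t ht
    have hδ' : HasDerivAt δ 0 t := hδ
    obtain ⟨e1, e2, e3, e4⟩ := hasDerivAt_components hδ'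
    refine ⟨?_, ?_, hasDerivAt_cos_angle_of_zero e3 ?_, hasDerivAt_cos_angle_of_zero e4 ?_⟩
    · refine (e1.const_add (d t).1).congr_of_eventuallyEq ?_
      filter_upwards [hev] with y hy
      rw [hy]; rfl
    · refine (e2.const_add (d t).2.1).congr_of_eventuallyEq ?_
      filter_upwards [hev] with y hy
      rw [hy]; rfl
    · filter_upwards [hev] with y hy
      rw [hy]; rfl
    · filter_upwards [hev] with y hy
      rw [hy]; rfl
  intro t ht
  refine Prod.ext ?_ (Prod.ext ?_ (Prod.ext ?_ ?_))
  · exact eq_left_of_hasDerivAt_zero (fun t ht => (key t ht).1) t ht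
  · exact eq_left_of_hasDerivAt_zero (fun t ht => (key t ht).2.1) t ht
  · exact angle_eq_of_cos_sin (eq_left_of_hasDerivAt_zero (fun t ht => (key t ht).2.2.1.1) t ht)
      (eq_left_of_hasDerivAt_zero (fun t ht => (key t ht).2.2.1.2) t ht)
  · exact angle_eq_of_cos_sin (eq_left_of_hasDerivAt_zero (fun t ht => (key t ht).2.2.2.1) t ht)
      (eq_left_of_hasDerivAt_zero (fun t ht => (key t ht).2.2.2.2) t ht)

/-- A continuous function on `[a, b]` has a primitive on the line. -/
theorem hasDerivAt_integral_IccExtend {E : Type*} [NormedAddCommGroup E] [NormedSpace ℝ E]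
    [CompleteSpace E] (hab : a ≤ b) {w : ℝ → E} (hw : ContinuousOn w (Icc a b)) {t : ℝ}
    (ht : t ∈ Icc a b) :
    HasDerivAt (fun t => ∫ s in a..t, IccExtend hab ((Icc a b).domRestrict w) s) (w t) t := by
  have hc : Continuous (IccExtend hab ((Icc a b).domRestrict w)) :=
    (continuousOn_iff_continuous_domRestrict.1 hw).Icc_extend'
  have := (hc.integral_hasStrictDerivAt a t).hasDerivAt
  rwa [IccExtend_of_mem _ _ ht] at this

theorem integral_IccExtend {E : Type*} [NormedAddCommGroup E] [NormedSpace ℝ E]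
    (hab : a ≤ b) (w : ℝ → E) {t : ℝ} (ht : t ∈ Icc a b) :
    ∫ s in a..t, IccExtend hab ((Icc a b).domRestrict w) s = ∫ s in a..t, w s :=
  integral_congr_Icc (fun s hs => by rw [IccExtend_of_mem _ _ hs]; rfl) ht

/-- A curve with continuous velocity is recovered from its velocity by integration. -/
theorem eq_add_cover_integral (hab : a ≤ b) {c : ℝ → Pos} {w : ℝ → Vec}
    (hw : ContinuousOn w (Icc a b)) (hc : ∀ t ∈ Icc a b, HasVelocityAt c (w t) t) :
    ∀ t ∈ Icc a b, c t = c a + cover (∫ s in a..t, w s) := by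
  set J : ℝ → Vec := fun t => ∫ s in a..t, IccExtend hab ((Icc a b).domRestrict w) s with hJdef
  have hJ : ∀ t ∈ Icc a b, HasDerivAt J (w t) t := fun t ht =>
    hasDerivAt_integral_IccExtend hab hw ht
  -- Subtracting the projected primitive leaves velocity zero, hence a constant.
  have hd : ∀ t ∈ Icc a b, HasVelocityAt (fun t => c t - cover (J t)) 0 t := fun t ht => by
    obtain ⟨δ, h0, hδ, hev⟩ := hc t ht
    have hδ' : HasDerivAt δ (w t) t := hδ
    refine ⟨fun y => δ y - (J y - J t), by simp [h0], ?_, ?_⟩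
    · have := hδ'.sub ((hJ t ht).sub_const (J t))
      rw [sub_self] at this
      exact this
    · filter_upwards [hev] with y hy
      rw [hy, cover_sub, cover_sub]
      abel
  intro t ht
  have h1 := eq_left_of_hasVelocityAt_zero hd t ht
  have h2 : J a = 0 := by simp [hJdef]
  have h3 : cover 0 = 0 := by simp [cover]
  rw [h2, h3, sub_zero] at h1
  rw [← integral_IccExtend hab w ht, ← h1]
  simp [hJdef]

theorem continuous_ξ (ℓ₁ ℓ₂ : ℝ) : Continuous (ξ ℓ₁ ℓ₂) := by
  have h1 := Real.Angle.continuous_sin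
  have h2 := Real.Angle.continuous_cos
  unfold ξ v₁ v₂
  fun_prop

theorem memLp_smul_continuousOn {f : ℝ → ℝ} {w : ℝ → Vec}
    (hf : MemLp f 2 (volume.restrict (Icc a b))) (hw : ContinuousOn w (Icc a b)) :
    MemLp (fun s => f s • w s) 2 (volume.restrict (Icc a b)) :=
  memLp_vec_iff.2 ⟨memLp_mul_continuousOn hf (by fun_prop),
    memLp_mul_continuousOn hf (by fun_prop), memLp_mul_continuousOn hf (by fun_prop),
    memLp_mul_continuousOn hf (by fun_prop)⟩

theorem memLp_vec_of_continuousOn {w : ℝ → Vec} (hw : ContinuousOn w (Icc a b)) :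
    MemLp w 2 (volume.restrict (Icc a b)) := by
  simpa using memLp_smul_continuousOn (memLp_const (1 : ℝ)) hw

/-! ### Curves along `ξ` are singular -/

/-- A curve whose velocity is a square integrable multiple of `ξ` is singular. -/
theorem isSingular_of_velocity {ℓ₁ ℓ₂ : ℝ} (hab : a < b) (h₁ : 0 < ℓ₁) (h₂ : 0 < ℓ₂)
    {γ : ℝ → Pos} (hγc : ContinuousOn γ (Icc a b)) {f : ℝ → ℝ}
    (hf : MemLp f 2 (volume.restrict (Icc a b)))
    (hγ : ∀ t ∈ Icc a b, γ t = γ a + cover (∫ s in a..t, f s • ξ ℓ₁ ℓ₂ (γ s))) :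
    IsSingular ℓ₁ ℓ₂ a b γ := by
  have c1 := Real.Angle.continuous_sin
  have c2 := Real.Angle.continuous_cos
  have hS : ContinuousOn (fun s => (γ s).2.2.1.sin / ℓ₁ - (γ s).2.2.2.sin / ℓ₂) (Icc a b) :=
    Continuous.comp_continuousOn (g := fun q : Pos => q.2.2.1.sin / ℓ₁ - q.2.2.2.sin / ℓ₂)
      (by fun_prop) hγc
  have hC : ContinuousOn (fun s => -((γ s).2.2.1.cos / ℓ₁ - (γ s).2.2.2.cos / ℓ₂)) (Icc a b) :=
    Continuous.comp_continuousOn (g := fun q : Pos => -(q.2.2.1.cos / ℓ₁ - q.2.2.2.cos / ℓ₂))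
      (by fun_prop) hγc
  have hξ : ContinuousOn (fun s => ξ ℓ₁ ℓ₂ (γ s)) (Icc a b) :=
    (continuous_ξ ℓ₁ ℓ₂).comp_continuousOn hγc
  rw [isSingular_iff hab h₁ h₂]
  have hae := controlOf_ae (memLp_mul_continuousOn hf hS) (memLp_mul_continuousOn hf hC)
  refine ⟨controlOf (memLp_mul_continuousOn hf hS) (memLp_mul_continuousOn hf hC), ?_, ?_⟩
  · have hw : ∀ᵐ s ∂(volume.restrict (Icc a b)), f s • ξ ℓ₁ ℓ₂ (γ s) =
        controlOf (memLp_mul_continuousOn hf hS) (memLp_mul_continuousOn hf hC) s 0 • v₁ ℓ₁ ℓ₂ (γ s)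
        + controlOf (memLp_mul_continuousOn hf hS) (memLp_mul_continuousOn hf hC) s 1
          • v₂ ℓ₁ ℓ₂ (γ s) := by
      filter_upwards [hae] with s hs
      rw [hs.1, hs.2, ξ]
      module
    have hm : MemLp (fun s => f s • ξ ℓ₁ ℓ₂ (γ s)) 2 (volume.restrict (Icc a b)) :=
      memLp_smul_continuousOn hf hξ
    refine ⟨hm.ae_eq hw, fun t ht => ?_⟩
    rw [hγ t ht]
    congr 2
    refine intervalIntegral.integral_congr_ae ?_
    rw [ae_restrict_Icc_iff hab.le] at hw
    filter_upwards [hw] with s hs hm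
    refine hs (uIcc_subset_uIcc_left ?_ (uIoc_subset_uIcc hm))
    rwa [uIcc_of_le hab.le]
  · filter_upwards [hae] with s hs
    rw [hs.1, hs.2]
    ring

theorem IsIntegralCurve.isSingular {ℓ₁ ℓ₂ : ℝ} (hab : a < b) (h₁ : 0 < ℓ₁) (h₂ : 0 < ℓ₂)
    {c : ℝ → Pos} (hc : IsIntegralCurve ℓ₁ ℓ₂ c (Icc a b)) : IsSingular ℓ₁ ℓ₂ a b c := by
  have hcc : ContinuousOn c (Icc a b) := fun t ht =>
    (hc t ht).2.continuousAt.continuousWithinAt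
  refine isSingular_of_velocity hab h₁ h₂ hcc (memLp_const (1 : ℝ)) ?_
  simp only [one_smul]
  exact eq_add_cover_integral hab.le ((continuous_ξ ℓ₁ ℓ₂).comp_continuousOn hcc)
    fun t ht => (hc t ht).2

/-- A reparametrization of an integral curve of `ξ` is singular. -/
theorem isSingular_of_reparam {ℓ₁ ℓ₂ : ℝ} (hab : a < b) (h₁ : 0 < ℓ₁) (h₂ : 0 < ℓ₂)
    {γ c : ℝ → Pos} (hc : IsIntegralCurve ℓ₁ ℓ₂ c univ) {φ : ℝ → ℝ} (hφ : IsH1 a b φ)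
    (hγ : ∀ t ∈ Icc a b, γ t = c (φ t)) : IsSingular ℓ₁ ℓ₂ a b γ := by
  obtain ⟨f, hf, hφf⟩ := hφ
  have hφp : IsPrimitiveOn a b φ f := ⟨MemLp.integrableOn_Icc hf, hφf⟩
  have hφc := hφp.continuousOn hab.le
  have hcc : Continuous c := continuous_iff_continuousAt.2 fun t =>
    (hc t (mem_univ t)).2.continuousAt
  have hγc : ContinuousOn γ (Icc a b) := (hcc.comp_continuousOn hφc).congr hγ
  have hξc : Continuous fun s => ξ ℓ₁ ℓ₂ (c s) := (continuous_ξ ℓ₁ ℓ₂).comp hcc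
  have hξγ : ContinuousOn (fun s => ξ ℓ₁ ℓ₂ (γ s)) (Icc a b) :=
    (continuous_ξ ℓ₁ ℓ₂).comp_continuousOn hγc
  refine isSingular_of_velocity hab h₁ h₂ hγc hf fun t ht => ?_
  -- Only the part of `c` over `[-M, M]` is used. Lifting it from the left end `-M` allows the chain
  -- rule to be applied to `J ∘ φ` in `ℝ⁴`.
  obtain ⟨M, hM⟩ := isCompact_Icc.exists_bound_of_continuousOn hφc
  have hM' : ∀ t ∈ Icc a b, φ t ∈ Icc (-M) M := fun t ht => abs_le.1 (hM t ht)
  have ha : a ∈ Icc a b := left_mem_Icc.2 hab.le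
  have hMM : -M ≤ M := (hM' a ha).1.trans (hM' a ha).2
  set J : ℝ → Vec := fun t => ∫ s in (-M)..t, ξ ℓ₁ ℓ₂ (c s)
  have hJ : ∀ t, HasDerivAt J (ξ ℓ₁ ℓ₂ (c t)) t := fun t =>
    (hξc.integral_hasStrictDerivAt (-M) t).hasDerivAt
  have hcJ : ∀ s ∈ Icc (-M) M, c s = c (-M) + cover (J s) :=
    eq_add_cover_integral hMM hξc.continuousOn fun t _ => (hc t (mem_univ t)).2
  have hcomp := fun s => hasDerivAt_components (hJ s)
  have D1 := (hφp.comp hab.le (fun s => (hcomp s).1) hξc.fst).2 t ht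
  have D2 := (hφp.comp hab.le (fun s => (hcomp s).2.1) hξc.snd.fst).2 t ht
  have D3 := (hφp.comp hab.le (fun s => (hcomp s).2.2.1) hξc.snd.snd.fst).2 t ht
  have D4 := (hφp.comp hab.le (fun s => (hcomp s).2.2.2) hξc.snd.snd.snd).2 t ht
  have hm : MemLp (fun s => f s • ξ ℓ₁ ℓ₂ (γ s)) 2 (volume.restrict (Icc a b)) :=
    memLp_smul_continuousOn hf hξγ
  have hint : ∫ s in a..t, f s • ξ ℓ₁ ℓ₂ (γ s) = J (φ t) - J (φ a) := by
    rw [integral_vec (intervalIntegrable_of_memLp hm ht)]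
    beta_reduce at D1 D2 D3 D4
    refine Prod.ext ?_ (Prod.ext ?_ (Prod.ext ?_ ?_))
    · rw [Prod.fst_sub, D1, add_sub_cancel_left]
      exact integral_congr_Icc (fun s hs => by rw [hγ s hs]; exact mul_comm _ _) ht
    · rw [Prod.snd_sub, Prod.fst_sub, D2, add_sub_cancel_left]
      exact integral_congr_Icc (fun s hs => by rw [hγ s hs]; exact mul_comm _ _) ht
    · rw [Prod.snd_sub, Prod.snd_sub, Prod.fst_sub, D3, add_sub_cancel_left]
      exact integral_congr_Icc (fun s hs => by rw [hγ s hs]; exact mul_comm _ _) ht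
    · rw [Prod.snd_sub, Prod.snd_sub, Prod.snd_sub, D4, add_sub_cancel_left]
      exact integral_congr_Icc (fun s hs => by rw [hγ s hs]; exact mul_comm _ _) ht
  rw [hint, hγ t ht, hγ a ha, hcJ _ (hM' t ht), hcJ _ (hM' a ha), cover_sub]
  abel

/-! ### Singular curves run along `ξ` -/

/-- `ξ` vanishes nowhere on the configuration space. -/
theorem sq_add_sq_ne_zero_of_mem_configSpace {ℓ₁ ℓ₂ : ℝ} (h₁ : 0 < ℓ₁) (h₂ : 0 < ℓ₂) {q : Pos}
    (hq : q ∈ configSpace ℓ₁ ℓ₂) :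
    (q.2.2.1.sin / ℓ₁ - q.2.2.2.sin / ℓ₂) ^ 2 + (q.2.2.1.cos / ℓ₁ - q.2.2.2.cos / ℓ₂) ^ 2 ≠ 0 := by
  intro h
  have hs : q.2.2.1.sin / ℓ₁ - q.2.2.2.sin / ℓ₂ = 0 := by
    nlinarith [sq_nonneg (q.2.2.1.sin / ℓ₁ - q.2.2.2.sin / ℓ₂),
      sq_nonneg (q.2.2.1.cos / ℓ₁ - q.2.2.2.cos / ℓ₂)]
  have hc : q.2.2.1.cos / ℓ₁ - q.2.2.2.cos / ℓ₂ = 0 := by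
    rw [hs] at h; simpa using h
  have hs' : q.2.2.1.sin * ℓ₂ = q.2.2.2.sin * ℓ₁ := by field_simp at hs; linarith
  have hc' : q.2.2.1.cos * ℓ₂ = q.2.2.2.cos * ℓ₁ := by field_simp at hc; linarith
  have e1 := Real.Angle.cos_sq_add_sin_sq q.2.2.1
  have e2 := Real.Angle.cos_sq_add_sin_sq q.2.2.2
  -- The vectors `(cos αᵢ, sin αᵢ) / ℓᵢ` coincide, hence so do their lengths `1 / ℓᵢ`, and then the
  -- angles.
  have hsq : ℓ₁ ^ 2 = ℓ₂ ^ 2 := by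
    linear_combination ℓ₂ ^ 2 * e1 - ℓ₁ ^ 2 * e2 - (q.2.2.1.sin * ℓ₂ + q.2.2.2.sin * ℓ₁) * hs'
      - (q.2.2.1.cos * ℓ₂ + q.2.2.2.cos * ℓ₁) * hc'
  have hℓ : ℓ₁ = ℓ₂ := (pow_left_inj₀ h₁.le h₂.le two_ne_zero).1 hsq
  subst hℓ
  exact hq rfl (angle_eq_of_cos_sin (mul_right_cancel₀ h₁.ne' hc') (mul_right_cancel₀ h₁.ne' hs'))

/-- The coefficient of `ξ` in the horizontal vector `c v₁ + d v₂`. -/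
def ξCoeff (ℓ₁ ℓ₂ : ℝ) (q : Pos) (c d : ℝ) : ℝ :=
  (c * (q.2.2.1.sin / ℓ₁ - q.2.2.2.sin / ℓ₂) - d * (q.2.2.1.cos / ℓ₁ - q.2.2.2.cos / ℓ₂))
    / ((q.2.2.1.sin / ℓ₁ - q.2.2.2.sin / ℓ₂) ^ 2 + (q.2.2.1.cos / ℓ₁ - q.2.2.2.cos / ℓ₂) ^ 2)

theorem ξCoeff_spec {ℓ₁ ℓ₂ c d : ℝ} (h₁ : 0 < ℓ₁) (h₂ : 0 < ℓ₂) {q : Pos}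
    (hq : q ∈ configSpace ℓ₁ ℓ₂)
    (ho : c * (q.2.2.1.cos / ℓ₁ - q.2.2.2.cos / ℓ₂)
      + d * (q.2.2.1.sin / ℓ₁ - q.2.2.2.sin / ℓ₂) = 0) :
    c = ξCoeff ℓ₁ ℓ₂ q c d * (q.2.2.1.sin / ℓ₁ - q.2.2.2.sin / ℓ₂) ∧
    d = -(ξCoeff ℓ₁ ℓ₂ q c d * (q.2.2.1.cos / ℓ₁ - q.2.2.2.cos / ℓ₂)) := by
  have hne := sq_add_sq_ne_zero_of_mem_configSpace h₁ h₂ hq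
  unfold ξCoeff
  set S := q.2.2.1.sin / ℓ₁ - q.2.2.2.sin / ℓ₂
  set C := q.2.2.1.cos / ℓ₁ - q.2.2.2.cos / ℓ₂
  constructor
  · rw [div_mul_eq_mul_div, eq_div_iff hne]
    linear_combination C * ho
  · rw [div_mul_eq_mul_div, ← neg_div, eq_div_iff hne]
    linear_combination S * ho

/-- The coefficient is linear in the control with factors continuous along `γ`, because `ξ` has no
zero there. Hence it is square integrable or continuous whenever the control is. -/
theorem exists_ξCoeff_eq {ℓ₁ ℓ₂ : ℝ} (h₁ : 0 < ℓ₁) (h₂ : 0 < ℓ₂) {γ : ℝ → Pos}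
    (hγ : ∀ t ∈ Icc a b, γ t ∈ configSpace ℓ₁ ℓ₂) (hγc : ContinuousOn γ (Icc a b)) :
    ∃ A B : ℝ → ℝ, ContinuousOn A (Icc a b) ∧ ContinuousOn B (Icc a b) ∧
      ∀ s c d, ξCoeff ℓ₁ ℓ₂ (γ s) c d = c * A s + d * B s := by
  have c1 := Real.Angle.continuous_sin
  have c2 := Real.Angle.continuous_cos
  have hS : ContinuousOn (fun s => (γ s).2.2.1.sin / ℓ₁ - (γ s).2.2.2.sin / ℓ₂) (Icc a b) :=
    Continuous.comp_continuousOn (g := fun q : Pos => q.2.2.1.sin / ℓ₁ - q.2.2.2.sin / ℓ₂)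
      (by fun_prop) hγc
  have hC : ContinuousOn (fun s => (γ s).2.2.1.cos / ℓ₁ - (γ s).2.2.2.cos / ℓ₂) (Icc a b) :=
    Continuous.comp_continuousOn (g := fun q : Pos => q.2.2.1.cos / ℓ₁ - q.2.2.2.cos / ℓ₂)
      (by fun_prop) hγc
  have hN := (hS.pow 2).add (hC.pow 2)
  have hne := fun s hs => sq_add_sq_ne_zero_of_mem_configSpace h₁ h₂ (hγ s hs)
  refine ⟨_, _, hS.div hN hne, (hC.div hN hne).neg, fun s c d => ?_⟩
  simp only [ξCoeff, Pi.div_apply, Pi.neg_apply, Pi.add_apply, Pi.pow_apply]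
  ring

theorem IsControlledBy.continuousOn {ℓ₁ ℓ₂ : ℝ} (hab : a ≤ b) {γ : ℝ → Pos} {u : Control a b}
    (hu : IsControlledBy ℓ₁ ℓ₂ a b γ u) : ContinuousOn γ (Icc a b) := by
  obtain ⟨z, hz⟩ := cover_surjective (γ a)
  have hγ := (isControlledBy_iff hab u hz.symm).1 hu
  refine ContinuousOn.congr (continuous_cover.comp_continuousOn ?_) hγ
  exact ((isPrimitiveOn_integral (Control.integrableOn u 0) z.1).continuousOn hab).prodMk
    (((isPrimitiveOn_integral (Control.integrableOn u 1) z.2.1).continuousOn hab).prodMk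
      ((continuousOn_liftAngle hab ℓ₁ _ u).prodMk (continuousOn_liftAngle hab ℓ₂ _ u)))

/-- A singular curve in the configuration space runs along an integral curve of `ξ`. -/
theorem IsSingular.exists_reparam {ℓ₁ ℓ₂ : ℝ} (hab : a < b) (h₁ : 0 < ℓ₁) (h₂ : 0 < ℓ₂)
    {γ : ℝ → Pos} (hγ : ∀ t ∈ Icc a b, γ t ∈ configSpace ℓ₁ ℓ₂) (hs : IsSingular ℓ₁ ℓ₂ a b γ) :
    ∃ c : ℝ → Pos, IsIntegralCurve ℓ₁ ℓ₂ c univ ∧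
      ∃ φ : ℝ → ℝ, IsH1 a b φ ∧ ∀ t ∈ Icc a b, γ t = c (φ t) := by
  obtain ⟨u, hu, ho⟩ := (isSingular_iff hab h₁ h₂ γ).1 hs
  obtain ⟨A, B, hA, hB, hAB⟩ := exists_ξCoeff_eq h₁ h₂ hγ (hu.continuousOn hab.le)
  have hf : MemLp (fun s => ξCoeff ℓ₁ ℓ₂ (γ s) (u s 0) (u s 1)) 2 (volume.restrict (Icc a b)) := by
    simp only [hAB]
    exact (memLp_mul_continuousOn (Control.memLp u 0) hA).add
      (memLp_mul_continuousOn (Control.memLp u 1) hB)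
  obtain ⟨c, hc, hγc⟩ := exists_integralCurve_eq hab.le (hγ a (left_mem_Icc.2 hab.le)) hu
    (MemLp.integrableOn_Icc hf) (by
      filter_upwards [ho, ae_restrict_mem measurableSet_Icc] with s hs hm
      exact ξCoeff_spec h₁ h₂ (hγ s hm) hs)
  exact ⟨c, hc, _, ⟨_, hf, fun t _ => by simp⟩, hγc⟩

/-- A continuous function with values in `2πℤ` that left `0` would have absolute value `π`
somewhere. -/
theorem eq_zero_of_angle_coe_eq_zero {g : ℝ → ℝ} (hg : ContinuousOn g (Icc a b)) (h0 : g a = 0)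
    (h : ∀ t ∈ Icc a b, (g t : Real.Angle) = 0) {t : ℝ} (ht : t ∈ Icc a b) : g t = 0 := by
  have small : ∀ s ∈ Icc a b, |g s| < 2 * Real.pi → g s = 0 := fun s hs hlt =>
    eq_of_angle_coe_eq (by rw [h s hs, Real.Angle.coe_zero]) (by simpa using hlt)
  by_contra hne
  have hbig : 2 * Real.pi ≤ |g t| := by
    by_contra! hlt
    exact hne (small t ht hlt)
  have hsub : Icc a t ⊆ Icc a b := Icc_subset_Icc_right ht.2
  obtain ⟨s, hs, hsπ⟩ := intermediate_value_Icc ht.1 (hg.mono hsub).abs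
    (show Real.pi ∈ Icc |g a| |g t| from
      ⟨by rw [h0, abs_zero]; exact Real.pi_pos.le, by linarith [Real.pi_pos]⟩)
  beta_reduce at hsπ
  have := small s (hsub hs) (by rw [hsπ]; linarith [Real.pi_pos])
  rw [this, abs_zero] at hsπ
  exact Real.pi_pos.ne hsπ

/-- The velocity of an absolutely continuous curve is determined almost everywhere. -/
theorem velocity_ae_eq (hab : a ≤ b) {w w' : ℝ → Vec}
    (hw : MemLp w 2 (volume.restrict (Icc a b))) (hw' : MemLp w' 2 (volume.restrict (Icc a b)))
    (h : ∀ t ∈ Icc a b, cover (∫ s in a..t, w s) = cover (∫ s in a..t, w' s)) :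
    ∀ᵐ s ∂(volume.restrict (Icc a b)), w s = w' s := by
  obtain ⟨m1, m2, m3, m4⟩ := memLp_vec_iff.1 hw
  obtain ⟨n1, n2, n3, n4⟩ := memLp_vec_iff.1 hw'
  have prim : ∀ {f : ℝ → ℝ}, MemLp f 2 (volume.restrict (Icc a b)) →
      IsPrimitiveOn a b (fun t => 0 + ∫ s in a..t, f s) f := fun hf =>
    isPrimitiveOn_integral (MemLp.integrableOn_Icc hf) 0
  have key : ∀ {f g : ℝ → ℝ}, MemLp f 2 (volume.restrict (Icc a b)) →
      MemLp g 2 (volume.restrict (Icc a b)) →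
      (∀ t ∈ Icc a b, ((∫ s in a..t, f s : ℝ) : Real.Angle) = (∫ s in a..t, g s : ℝ)) →
      ∀ᵐ s ∂(volume.restrict (Icc a b)), f s = g s := fun {f g} hf hg hfg => by
    refine (prim hf).ae_eq ((prim hg).congr_left hab fun t ht => ?_) hab
    have := eq_zero_of_angle_coe_eq_zero
      (((prim hf).sub (prim hg)).continuousOn hab) (by simp) (fun t ht => by
        simp [hfg t ht]) ht
    exact (sub_eq_zero.1 this).symm
  have h' : ∀ t ∈ Icc a b, _ := fun t ht => by
    have := h t ht
    rw [integral_vec (intervalIntegrable_of_memLp hw ht),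
      integral_vec (intervalIntegrable_of_memLp hw' ht)] at this
    simpa only [cover, Prod.mk.injEq] using this
  -- The first two components agree as real numbers; reducing them modulo `2π` lets one argument
  -- serve all four.
  filter_upwards [key m1 n1 fun t ht => congrArg _ (h' t ht).1,
    key m2 n2 fun t ht => congrArg _ (h' t ht).2.1, key m3 n3 fun t ht => (h' t ht).2.2.1,
    key m4 n4 fun t ht => (h' t ht).2.2.2] with s e1 e2 e3 e4
  exact Prod.ext e1 (Prod.ext e2 (Prod.ext e3 e4))

/-- A regular singular curve is a regular reparametrization of an integral curve of `ξ`. -/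
theorem IsSingular.exists_regularReparam {ℓ₁ ℓ₂ : ℝ} (hab : a < b) (h₁ : 0 < ℓ₁) (h₂ : 0 < ℓ₂)
    {γ : ℝ → Pos} (hγ : ∀ t ∈ Icc a b, γ t ∈ configSpace ℓ₁ ℓ₂) (hr : IsRegularCurve a b γ)
    (hs : IsSingular ℓ₁ ℓ₂ a b γ) :
    ∃ c : ℝ → Pos, IsIntegralCurve ℓ₁ ℓ₂ c univ ∧
      ∃ φ : ℝ → ℝ, IsRegularReparam a b φ ∧ ∀ t ∈ Icc a b, γ t = c (φ t) := by
  obtain ⟨u, hu, ho⟩ := (isSingular_iff hab h₁ h₂ γ).1 hs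
  obtain ⟨w, hwc, hw0, hγw⟩ := hr
  have hγc := hu.continuousOn hab.le
  obtain ⟨A, B, hA, hB, hAB⟩ := exists_ξCoeff_eq h₁ h₂ hγ hγc
  have hwu := velocity_ae_eq hab.le (memLp_vec_of_continuousOn hwc) hu.1 fun t ht =>
    add_left_cancel ((hγw t ht).symm.trans (hu.2 t ht))
  -- Built from the continuous velocity `w` and not from the control `u`, which is only an almost
  -- everywhere class; this makes `f` continuous.
  set f : ℝ → ℝ := fun s => ξCoeff ℓ₁ ℓ₂ (γ s) (w s).1 (w s).2.1 with hf
  have hfc : ContinuousOn f (Icc a b) := by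
    simp only [hf, hAB]
    fun_prop
  have hfu : ∀ᵐ s ∂(volume.restrict (Icc a b)),
      u s 0 = f s * ((γ s).2.2.1.sin / ℓ₁ - (γ s).2.2.2.sin / ℓ₂) ∧
      u s 1 = -(f s * ((γ s).2.2.1.cos / ℓ₁ - (γ s).2.2.2.cos / ℓ₂)) := by
    filter_upwards [ho, hwu, ae_restrict_mem measurableSet_Icc] with s hs e hm
    have e1 : (w s).1 = u s 0 := by rw [e]; simp [v₁, v₂]
    have e2 : (w s).2.1 = u s 1 := by rw [e]; simp [v₁, v₂]
    simp only [hf, e1, e2]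
    exact ξCoeff_spec h₁ h₂ (hγ s hm) hs
  have hwf : EqOn w (fun s => f s • ξ ℓ₁ ℓ₂ (γ s)) (Icc a b) := by
    refine Measure.eqOn_Icc_of_ae_eq volume hab.ne ?_ hwc
      (hfc.smul ((continuous_ξ ℓ₁ ℓ₂).comp_continuousOn hγc))
    filter_upwards [hwu, hfu] with s e hs
    rw [e, hs.1, hs.2, ξ]
    module
  obtain ⟨c, hc, hγφ⟩ := exists_integralCurve_eq hab.le (hγ a (left_mem_Icc.2 hab.le)) hu
    hfc.integrableOn_Icc hfu
  -- Since `w = f ξ` at every point of `[a, b]`, a zero of `f` would be a zero of the velocity.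
  refine ⟨c, hc, _, ⟨f, hfc, fun t ht h0 => hw0 t ht ?_, fun t ht => ?_⟩, hγφ⟩
  · rw [hwf ht]
    simp [h0]
  · exact (hasDerivAt_integral_IccExtend hab.le hfc ht).hasDerivWithinAt.congr
      (fun s hs => (integral_IccExtend hab.le f hs).symm) (integral_IccExtend hab.le f ht).symm

theorem IsRegularReparam.isH1 {φ : ℝ → ℝ} (hφ : IsRegularReparam a b φ) : IsH1 a b φ := by
  obtain ⟨f, hfc, -, hd⟩ := hφ
  exact ⟨f, memLp_of_continuousOn hfc, (isPrimitiveOn_of_hasDerivWithinAt hd hfc).2⟩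

end TwoLinkage

end

theorem theorem4p1 (ℓ₁ ℓ₂ : ℝ) (h₁ : 0 < ℓ₁) (h₂ : 0 < ℓ₂) (a b : ℝ) (hab : a < b) :
    -- integral curves of `ξ` are singular curves
    (∀ c : ℝ → TwoLinkage.Pos, TwoLinkage.IsIntegralCurve ℓ₁ ℓ₂ c (Set.Icc a b) →
      TwoLinkage.IsSingular ℓ₁ ℓ₂ a b c) ∧
    -- regular singular curves are integral curves of `ξ` up to a regular change of parameter
    (∀ γ : ℝ → TwoLinkage.Pos, (∀ t ∈ Set.Icc a b, γ t ∈ TwoLinkage.configSpace ℓ₁ ℓ₂) →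
      TwoLinkage.IsRegularCurve a b γ →
      (TwoLinkage.IsSingular ℓ₁ ℓ₂ a b γ ↔
        ∃ c : ℝ → TwoLinkage.Pos, TwoLinkage.IsIntegralCurve ℓ₁ ℓ₂ c Set.univ ∧
          ∃ φ : ℝ → ℝ, TwoLinkage.IsRegularReparam a b φ ∧ ∀ t ∈ Set.Icc a b, γ t = c (φ t))) ∧
    -- arbitrary singular curves run along integral curves of `ξ`
    (∀ γ : ℝ → TwoLinkage.Pos, (∀ t ∈ Set.Icc a b, γ t ∈ TwoLinkage.configSpace ℓ₁ ℓ₂) →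
      (TwoLinkage.IsSingular ℓ₁ ℓ₂ a b γ ↔
        ∃ c : ℝ → TwoLinkage.Pos, TwoLinkage.IsIntegralCurve ℓ₁ ℓ₂ c Set.univ ∧
          ∃ φ : ℝ → ℝ, TwoLinkage.IsH1 a b φ ∧ ∀ t ∈ Set.Icc a b, γ t = c (φ t))) := by
  refine ⟨fun c hc => hc.isSingular hab h₁ h₂, fun γ hγ hr => ⟨fun hs =>
    hs.exists_regularReparam hab h₁ h₂ hγ hr, ?_⟩, fun γ hγ => ⟨fun hs =>
    hs.exists_reparam hab h₁ h₂ hγ, ?_⟩⟩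
  · rintro ⟨c, hc, φ, hφ, hcφ⟩
    exact TwoLinkage.isSingular_of_reparam hab h₁ h₂ hc hφ.isH1 hcφ
  · rintro ⟨c, hc, φ, hφ, hcφ⟩
    exact TwoLinkage.isSingular_of_reparam hab h₁ h₂ hc hφ hcφ
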